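/- **Setting.** Fix $q\ge1$ and consider $n$ spins with Hilbert space $(\mathbb C^q)^{\otimes n}$. For $\Lambda\subseteq[n]=\{1,\dots,n\}$ let $\mathcal O_\Lambda$ be the self-adjoint operators acting only on the spins in $\Lambda$; write $\|\cdot\|$ for the operator norm. The local norm of an observable $O\in\mathcal O_{[n]}$ is $$\|O\|_{\rm loc}=2\min\Big\{\max_{x\in[n]}\sum_{\Lambda\ni x}\|h_\Lambda\| \;:\; O=\sum_{\Lambda\subseteq[n]}h_\Lambda,\ h_\Lambda\in\mathcal O_\Lambda\Big\}.$$ An operator is $k$-local if it is a sum of operators acting on at most $k$ spins each. For a traceless self-adjoint $X$ put $$\|X\|_{k\text{-}W_1\rm loc}=\max\{\mathrm{Tr}[XO] : O\in\mathcal O_{[n]}\ k\text{-local},\ \|O\|_{\rm loc}\le1\}.$$ For $H\in\mathcal O_{[n]}$ and $\beta\ge 0$ the Gibbs state is $\omega=e^{-\beta H}/\mathrm{Tr}\,e^{-\beta H}$. For $E\in\mathbb R$ and $\Delta>0$ let $P(E,\Delta)$ be the orthogonal projector onto the span of the eigenvectors of $H$ with eigenvalue in $(E-\Delta,E]$; the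 microcanonical state is $\omega_{E,\Delta}=P(E,\Delta)/\mathrm{Tr}\,P(E,\Delta)$. **Theorem.** Let $k\in\mathbb N$, $d\ge1$, $A,\xi,C>0$, $\beta\ge0$ and $M$ be real constants ($M$ is used only if $\beta=0$), and let $(\Delta_n)_{n}$ be a sequence of positive numbers with $$\Delta_n=\exp\!\big(-o(n^{\frac1{2d+1}})\big)\qquad\text{and}\qquad \Delta_n=o\big(n^{\frac1{2d+1}}\big)\qquad(n\to\infty).$$ Then for every $\varepsilon>0$ there is $N$ such that for all $n\ge N$ the following holds. Let $\mathsf d$ be a metric on $[n]$ with $$|\{x\in[n]:\mathsf d(x,v)\le r\}|\le A\,r^d\qquad\text{for all } v\in[n],\ r\ge1,$$ let $H\in\mathcal O_{[n]}$ (if $\beta=0$, assume also $\|H\|_{\rm loc}\le M$), and suppose that its Gibbs state $\omega$ at inverse temperature $\beta$ has correlation length $\xi$ with constant $C$: for all disjoint nonempty $\Lambda_1,\Lambda_2\subset[n]$ and all $h_1\in\mathcal O_{\Lambda_1}$, $h_2\in\mathcal O_{\Lambda_2}$, $$\big|\mathrm{Tr}[\omega h_1h_2]-\mathrm{Tr}[\omega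 h_1]\,\mathrm{Tr}[\omega h_2]\big|\le C\,\|h_1\|\,\|h_2\|\,e^{-\mathsf d(\Lambda_1,\Lambda_2)/\xi},\qquad \mathsf d(\Lambda_1,\Lambda_2)=\min_{x_1\in\Lambda_1,\,x_2\in\Lambda_2}\mathsf d(x_1,x_2).$$ Let $E^*$ be any maximizer over $E\in\mathbb R$ of $e^{-\beta E}\,\mathrm{Tr}\,P(E,\Delta_n)$. Then $$\frac1n\big\|\omega_{E^*,\Delta_n}-\omega\big\|_{k\text{-}W_1\rm loc}<\varepsilon .$$ That is, $\frac1n\|\omega_{E^*,\Delta_n}-\omega\|_{k\text{-}W_1\rm loc}=o(1)$ as $n\to\infty$, uniformly over all such systems: the canonical and microcanonical ensembles are equivalent. -/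

import Mathlib

noncomputable section

namespace SpinSystem

/-- Labels of the product basis of `(ℂ^q)^{⊗ n}`. -/
abbrev Config (n q : ℕ) : Type := Fin n → Fin q

/-- Linear operators on `(ℂ^q)^{⊗ n}`, written as matrices in the product basis. -/
abbrev Op (n q : ℕ) : Type := Matrix (Config n q) (Config n q) ℂ

variable {n q : ℕ}

/-- The operator norm (with respect to the Hilbert space norm). -/
def opNorm (X : Op n q) : ℝ := ‖Matrix.toEuclideanCLM (𝕜 := ℂ) X‖

/-- `X ⊗ I`: an operator `X` on the Hilbert space `⊗_{x ∈ Λ} ℂ^q` of the region `Λ`, tensored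
with the identity on the spins outside `Λ`. -/
def embed (Λ : Finset (Fin n)) (X : Matrix (Λ → Fin q) (Λ → Fin q) ℂ) : Op n q :=
  open Classical in
  fun s t => if ∀ x, x ∉ Λ → s x = t x then X (fun x => s x) (fun x => t x) else 0

/-- The linear operators that act only on the spins in `Λ`. -/
def ActsOn (Λ : Finset (Fin n)) (Y : Op n q) : Prop :=
  ∃ X : Matrix (Λ → Fin q) (Λ → Fin q) ℂ, Y = embed Λ X

/-- The observables of the region `Λ`: self-adjoint operators acting only on the spins in `Λ`. -/
def IsObservableOn (Λ : Finset (Fin n)) (Y : Op n q) : Prop :=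
  ∃ X : Matrix (Λ → Fin q) (Λ → Fin q) ℂ, X.IsHermitian ∧ Y = embed Λ X

/-- `h` is a decomposition `H = ∑_Λ h_Λ` into observables of the regions `Λ`. -/
def IsLocalDecomposition (H : Op n q) (h : Finset (Fin n) → Op n q) : Prop :=
  (∀ Λ, IsObservableOn Λ (h Λ)) ∧ H = ∑ Λ, h Λ

/-- The local norm of an observable: twice the minimum over all local decompositions of the
maximum over the spins `x` of `∑_{Λ ∋ x} ‖h_Λ‖`. -/
def localNorm (H : Op n q) : ℝ :=
  2 * sInf {m : ℝ | ∃ h : Finset (Fin n) → Op n q, IsLocalDecomposition H h ∧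
    m = ⨆ x : Fin n, ∑ Λ with x ∈ Λ, opNorm (h Λ)}

/-- `k`-local operators: sums of operators acting on at most `k` spins each. -/
def IsKLocal (k : ℕ) (X : Op n q) : Prop :=
  ∃ Y : Finset (Fin n) → Op n q,
    (∀ Λ, ActsOn Λ (Y Λ)) ∧ X = ∑ Λ with Λ.card ≤ k, Y Λ

/-- The `k`-local quantum `W₁` norm of a traceless self-adjoint operator: the norm dual to the
local norm on the `k`-local observables. The supremum is over a nonempty set that is bounded
above, see `bddAbove_kLocalW1Norm`. -/
def kLocalW1Norm (k : ℕ) (X : Op n q) : ℝ :=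
  sSup {w : ℝ | ∃ H : Op n q, H.IsHermitian ∧ IsKLocal k H ∧ localNorm H ≤ 1 ∧
    w = (X * H).trace.re}

/-- The Gibbs state `e^{-βH} / Tr e^{-βH}`. -/
def gibbsState (β : ℝ) (H : Op n q) : Op n q :=
  (NormedSpace.exp (-(β : ℂ) • H)).trace⁻¹ • NormedSpace.exp (-(β : ℂ) • H)

/-- The span of the eigenvectors of `H` with eigenvalue in `(E - Δ, E]`. -/
def shellSubspace (H : Op n q) (E Δ : ℝ) : Submodule ℂ (EuclideanSpace ℂ (Config n q)) :=
  Submodule.span ℂ {v | ∃ μ : ℝ, E - Δ < μ ∧ μ ≤ E ∧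
    Matrix.toEuclideanCLM (𝕜 := ℂ) H v = (μ : ℂ) • v}

/-- `P(E, Δ)`: the orthogonal projector onto the energy shell `(E - Δ, E]`. -/
def shellProjector (H : Op n q) (E Δ : ℝ) : Op n q :=
  (Matrix.toEuclideanCLM (𝕜 := ℂ)).symm (shellSubspace H E Δ).starProjection

/-- The microcanonical state `P(E, Δ) / Tr P(E, Δ)`. -/
def microcanonicalState (H : Op n q) (E Δ : ℝ) : Op n q :=
  (shellProjector H E Δ).trace⁻¹ • shellProjector H E Δ

/-- `E` maximizes `E' ↦ e^{-βE'} Tr P(E', Δ)` over the real line. -/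
def IsOptimalEnergy (β : ℝ) (H : Op n q) (Δ E : ℝ) : Prop :=
  ∀ E' : ℝ, Real.exp (-β * E') * (shellProjector H E' Δ).trace.re ≤
    Real.exp (-β * E) * (shellProjector H E Δ).trace.re

/-- The distance on the spins has balls with radius `r` of size at most `A r^d`. Every ball
contains its centre, so that this can only be asked for radii bounded away from `0`. -/
def BallGrowth (D : MetricSpace (Fin n)) (A d : ℝ) : Prop :=
  ∀ (v : Fin n) (r : ℝ), 1 ≤ r → (({x : Fin n | D.dist x v ≤ r}.ncard : ℕ) : ℝ) ≤ A * r ^ d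

/-- `min {D(x₁, x₂) : x₁ ∈ Λ₁, x₂ ∈ Λ₂}`, for nonempty regions. -/
def regionDist (D : MetricSpace (Fin n)) (Λ₁ Λ₂ : Finset (Fin n)) : ℝ :=
  sInf {r : ℝ | ∃ x₁ ∈ Λ₁, ∃ x₂ ∈ Λ₂, r = D.dist x₁ x₂}

/-- The state `ω` has correlation length `ξ` with constant `C`. -/
def HasCorrelationLength (D : MetricSpace (Fin n)) (ω : Op n q) (ξ C : ℝ) : Prop :=
  ∀ Λ₁ Λ₂ : Finset (Fin n), Λ₁.Nonempty → Λ₂.Nonempty → Disjoint Λ₁ Λ₂ →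
    ∀ h₁ h₂ : Op n q, IsObservableOn Λ₁ h₁ → IsObservableOn Λ₂ h₂ →
      ‖(ω * (h₁ * h₂)).trace - (ω * h₁).trace * (ω * h₂).trace‖ ≤
        C * (opNorm h₁ * opNorm h₂) * Real.exp (-(regionDist D Λ₁ Λ₂) / ξ)

theorem isObservableOn_univ {H : Op n q} (hH : H.IsHermitian) :
    IsObservableOn Finset.univ H := by
  refine ⟨fun s t => H (fun x => s ⟨x, Finset.mem_univ x⟩) (fun x => t ⟨x, Finset.mem_univ x⟩),
    ?_, ?_⟩
  · ext s t
    exact hH.apply _ _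
  · ext s t
    simp [embed]

theorem isObservableOn_zero (Λ : Finset (Fin n)) : IsObservableOn Λ (0 : Op n q) :=
  ⟨0, Matrix.isHermitian_zero, by ext s t; simp [embed]⟩

theorem opNorm_nonneg (X : Op n q) : 0 ≤ opNorm X := norm_nonneg _

/-- An observable has a local decomposition, so that the infimum in `localNorm` is over a
nonempty set. -/
theorem exists_localDecomposition {H : Op n q} (hH : H.IsHermitian) :
    ∃ h : Finset (Fin n) → Op n q, IsLocalDecomposition H h := by
  classical
  refine ⟨fun Λ => if Λ = Finset.univ then H else 0, fun Λ => ?_, ?_⟩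
  · by_cases h : Λ = Finset.univ
    · subst h; simpa using isObservableOn_univ hH
    · simpa [h] using isObservableOn_zero Λ
  · simp

/-- The supremum that defines the `k`-local quantum `W₁` norm of a traceless operator is over a
set that is bounded above. -/
theorem bddAbove_kLocalW1Norm (k : ℕ) {X : Op n q} (hX : X.trace = 0) :
    BddAbove {w : ℝ | ∃ H : Op n q, H.IsHermitian ∧ IsKLocal k H ∧ localNorm H ≤ 1 ∧
      w = (X * H).trace.re} := by
  classical
  obtain ⟨K, hK0, hK⟩ : ∃ K : ℝ, 0 ≤ K ∧ ∀ Y : Op n q, (X * Y).trace.re ≤ K * opNorm Y := by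
    let L : (EuclideanSpace ℂ (Config n q) →L[ℂ] EuclideanSpace ℂ (Config n q)) →ₗ[ℂ] ℂ :=
      { toFun := fun T => (X * (Matrix.toEuclideanCLM (𝕜 := ℂ)).symm T).trace
        map_add' := fun S T => by simp [mul_add]
        map_smul' := fun c T => by simp }
    refine ⟨‖LinearMap.toContinuousLinearMap L‖, ContinuousLinearMap.opNorm_nonneg _, fun Y => ?_⟩
    have h := (LinearMap.toContinuousLinearMap L).le_opNorm (Matrix.toEuclideanCLM (𝕜 := ℂ) Y)
    have h2 : (LinearMap.toContinuousLinearMap L) (Matrix.toEuclideanCLM (𝕜 := ℂ) Y)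
        = (X * Y).trace := by simp [L]
    rw [h2] at h
    exact (Complex.re_le_norm _).trans h
  refine ⟨K * (n : ℝ), ?_⟩
  rintro w ⟨H, hH, -, hloc, rfl⟩
  obtain ⟨h₀, hh₀⟩ := exists_localDecomposition hH
  have hlt : sInf {m : ℝ | ∃ h : Finset (Fin n) → Op n q, IsLocalDecomposition H h ∧
      m = ⨆ x : Fin n, ∑ Λ with x ∈ Λ, opNorm (h Λ)} < 1 := by
    unfold localNorm at hloc; linarith
  obtain ⟨m, ⟨h, ⟨hobs, hsum⟩, rfl⟩, hm⟩ := exists_lt_of_csInf_lt (by exact ⟨_, h₀, hh₀, rfl⟩) hlt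
  have hx : ∀ x : Fin n, ∑ Λ with x ∈ Λ, opNorm (h Λ) ≤ 1 := fun x =>
    (le_ciSup (f := fun x : Fin n => ∑ Λ with x ∈ Λ, opNorm (h Λ))
      (Set.finite_range _).bddAbove x).trans hm.le
  have hempty : (X * h ∅).trace = 0 := by
    obtain ⟨Y, -, hY⟩ := hobs ∅
    have hs : h ∅ = (Y (fun x => (Finset.notMem_empty _ x.2).elim) (fun x => (Finset.notMem_empty _ x.2).elim)) •
        (1 : Op n q) := by
      rw [hY]
      ext s t
      by_cases hst : s = t
      · subst hst
        simp only [embed, Matrix.smul_apply, Matrix.one_apply_eq, smul_eq_mul, mul_one]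
        simp only [implies_true, if_true]
        congr 1 <;> (funext x; exact (Finset.notMem_empty _ x.2).elim)
      · have : ¬ ∀ x, s x = t x := fun h => hst (funext h)
        simp [embed, Matrix.one_apply_ne hst, this]
    rw [hs]; simp [hX]
  calc (X * H).trace.re = ∑ Λ, (X * h Λ).trace.re := by
        rw [hsum, Finset.mul_sum, Matrix.trace_sum, Complex.re_sum]
    _ ≤ ∑ Λ : Finset (Fin n), K * ((Λ.card : ℝ) * opNorm (h Λ)) := by
        refine Finset.sum_le_sum fun Λ _ => ?_
        rcases Λ.eq_empty_or_nonempty with rfl | hΛ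
        · simp [hempty]
        · refine (hK _).trans (mul_le_mul_of_nonneg_left ?_ hK0)
          have : (1 : ℝ) ≤ Λ.card := by exact_mod_cast hΛ.card_pos
          nlinarith [opNorm_nonneg (h Λ)]
    _ = K * ∑ x : Fin n, ∑ Λ with x ∈ Λ, opNorm (h Λ) := by
        rw [← Finset.mul_sum]
        congr 1
        simp_rw [Finset.sum_filter]
        rw [Finset.sum_comm]
        refine Finset.sum_congr rfl fun Λ _ => ?_
        rw [← Finset.sum_filter]
        simp
    _ ≤ K * (n : ℝ) := by
        refine mul_le_mul_of_nonneg_left ?_ hK0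
        refine (Finset.sum_le_sum fun x _ => hx x).trans ?_
        simp

end SpinSystem

end

/-! ### Algebra and norms of local operators -/

noncomputable section
namespace SpinSystem
variable {n q : ℕ}

/-! The spectrum that matters for the partition function is covered by `T / Δ + 2` shells of width
`Δ`, where `T` is linear in `n`. The optimal shell therefore carries at least a fraction `1 / K` of
the Gibbs weight, with `K = exp (o(n^(1/(2d+1))))` (`partition_le`, `eventually_shell_factor_le`).
Both states are diagonal in the same eigenbasis, so the microcanonical state `ρ` is dominated by `K
ω` as an operator (`posSemidef_smul_gibbsState_sub`).

Domination is useful for observables whose high moments under `ω` are so small that they absorb `K`.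
Let `S` be the sum of the centred terms, on at most `L` spins each, of a decomposition of `O`.
Jensen's inequality and domination give `(Tr ρS)^(2m) ≤ Tr ρS^(2m) ≤ K Tr ωS^(2m)`. In the expansion
of `S^(2m)`, a product in which one factor is at distance more than `r` from all others has
expectation of relative size `e^(-r/ξ)`, by clustering and centring. In the remaining products every
factor has a neighbour, and a dominating set argument leaves only about `m` free factors
(`sum_prod_nonisolated_le`, `norm_trace_mul_sum_pow_le`).

The terms on more than `L` spins have total norm at most `n / L`, and the scalar part is invisible
to a difference of states (`re_trace_sub_mul_le`). With `m ≈ n^(1/(2d+1))` and `r = θm`, `K` is at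
most `4^m`, the tail `e^(-r/ξ)` is the `m`-th power of a small constant, and the neighbour count, of
order `m^(d+1)`, is `o(n)`. Hence `Tr ρS ≤ εn/4` (`moment_bound_le`). -/

theorem embed_apply (Λ : Finset (Fin n)) (X : Matrix (Λ → Fin q) (Λ → Fin q) ℂ)
    (s t : Config n q) [Decidable (∀ x, x ∉ Λ → s x = t x)] :
    embed Λ X s t = if ∀ x, x ∉ Λ → s x = t x then X (fun x => s x) (fun x => t x) else 0 := by
  unfold embed
  congr

theorem embed_add (Λ : Finset (Fin n)) (X Y : Matrix (Λ → Fin q) (Λ → Fin q) ℂ) :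
    embed Λ (X + Y) = embed Λ X + embed Λ Y := by
  classical
  ext s t
  simp only [embed_apply, Matrix.add_apply]
  split_ifs <;> simp

theorem embed_smul (Λ : Finset (Fin n)) (c : ℂ) (X : Matrix (Λ → Fin q) (Λ → Fin q) ℂ) :
    embed Λ (c • X) = c • embed Λ X := by
  classical
  ext s t
  simp only [embed_apply, Matrix.smul_apply]
  split_ifs <;> simp

theorem embed_conjTranspose (Λ : Finset (Fin n)) (X : Matrix (Λ → Fin q) (Λ → Fin q) ℂ) :
    embed Λ X.conjTranspose = (embed Λ X).conjTranspose := by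
  classical
  ext s t
  simp only [embed_apply, Matrix.conjTranspose_apply]
  have : (∀ x, x ∉ Λ → s x = t x) ↔ (∀ x, x ∉ Λ → t x = s x) :=
    forall₂_congr fun _ _ => eq_comm
  by_cases h : ∀ x, x ∉ Λ → s x = t x
  · rw [if_pos h, if_pos (this.1 h)]
  · rw [if_neg h, if_neg (fun h' => h (this.2 h')), star_zero]

theorem embed_one (Λ : Finset (Fin n)) :
    embed Λ (1 : Matrix (Λ → Fin q) (Λ → Fin q) ℂ) = 1 := by
  classical
  ext s t
  simp only [embed_apply, Matrix.one_apply]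
  by_cases h : s = t
  · subst h; simp
  · rw [if_neg h]
    split_ifs with h1 h2
    · refine absurd (funext fun x => ?_) h
      by_cases hx : x ∈ Λ
      · exact congrFun h2 ⟨x, hx⟩
      · exact h1 x hx
    · rfl
    · rfl

/-- The configuration that is `a` on `Λ` and `s` off `Λ`. -/
def glue (Λ : Finset (Fin n)) (a : Λ → Fin q) (s : Config n q) : Config n q :=
  open Classical in fun x => if h : x ∈ Λ then a ⟨x, h⟩ else s x

theorem glue_of_mem {Λ : Finset (Fin n)} {a : Λ → Fin q} {s : Config n q} {x : Fin n}
    (h : x ∈ Λ) : glue Λ a s x = a ⟨x, h⟩ := by simp [glue, h]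

theorem glue_of_notMem {Λ : Finset (Fin n)} {a : Λ → Fin q} {s : Config n q} {x : Fin n}
    (h : x ∉ Λ) : glue Λ a s x = s x := by simp [glue, h]

/-- An intermediate configuration contributes only if it agrees with `s` off `Λ`. These
configurations are exactly the `glue Λ a s`, so the matrix product reduces to a sum over `a`. -/
theorem embed_mul (Λ : Finset (Fin n)) (X Y : Matrix (Λ → Fin q) (Λ → Fin q) ℂ) :
    embed Λ (X * Y) = embed Λ X * embed Λ Y := by
  classical
  ext s t
  rw [Matrix.mul_apply]
  have hzero : ∀ u : Config n q, u ∉ Set.range (fun a => glue Λ a s) →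
      embed Λ X s u * embed Λ Y u t = 0 := by
    intro u hu
    have : ¬ ∀ x, x ∉ Λ → s x = u x := by
      intro h
      refine hu ⟨fun x => u x, funext fun x => ?_⟩
      by_cases hx : x ∈ Λ
      · simp [glue_of_mem hx]
      · simp [glue_of_notMem hx, h x hx]
    rw [embed_apply, if_neg this, zero_mul]
  have hinj : Function.Injective (fun a => glue Λ a s) := by
    intro a b hab
    funext x
    have := congrFun hab x
    simpa [glue_of_mem x.2] using this
  have hoff : (∀ x, x ∉ Λ → s x = t x) ↔ ∀ a : Λ → Fin q, ∀ x, x ∉ Λ → glue Λ a s x = t x :=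
    ⟨fun h a x hx => by rw [glue_of_notMem hx, h x hx],
      fun h x hx => by rw [← h (fun y => s y) x hx, glue_of_notMem hx]⟩
  have hon : ∀ a : Λ → Fin q, (fun x : Λ => glue Λ a s x) = a :=
    fun a => funext fun x => by simp [glue_of_mem x.2]
  rw [← Fintype.sum_of_injective (fun a => glue Λ a s) hinj
    (fun a => if ∀ x, x ∉ Λ → s x = t x then X (fun x => s x) a * Y a (fun x => t x) else 0)
    _ hzero]
  · rw [embed_apply]
    split_ifs with h
    · rw [Matrix.mul_apply]
    · simp
  · intro a
    have h1 : ∀ x, x ∉ Λ → s x = glue Λ a s x := fun x hx => (glue_of_notMem hx).symm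
    rw [embed_apply, embed_apply, if_pos h1, hon]
    by_cases h : ∀ x, x ∉ Λ → s x = t x
    · rw [if_pos h, if_pos (hoff.1 h a)]
    · rw [if_neg h, if_neg, mul_zero]
      exact fun h' => h fun x hx => by rw [← h' x hx, glue_of_notMem hx]

/-- The only intermediate configuration that contributes is `t` on `Λ` and `s` elsewhere. The
resulting formula is symmetric in the two regions, which gives commutation. -/
theorem embed_mul_embed_of_disjoint {Λ Λ' : Finset (Fin n)} (hd : Disjoint Λ Λ')
    (X : Matrix (Λ → Fin q) (Λ → Fin q) ℂ) (Y : Matrix (Λ' → Fin q) (Λ' → Fin q) ℂ)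
    (s t : Config n q) [Decidable (∀ x, x ∉ Λ → x ∉ Λ' → s x = t x)] :
    (embed Λ X * embed Λ' Y) s t = if ∀ x, x ∉ Λ → x ∉ Λ' → s x = t x then
      X (fun x => s x) (fun x => t x) * Y (fun x => s x) (fun x => t x) else 0 := by
  classical
  have hd' : ∀ x, x ∈ Λ → x ∉ Λ' := fun x h h' => Finset.disjoint_left.1 hd h h'
  rw [Matrix.mul_apply, Finset.sum_eq_single (glue Λ (fun x => t x) s)]
  · have h1 : ∀ x, x ∉ Λ → s x = glue Λ (fun x => t x) s x :=
      fun x hx => (glue_of_notMem hx).symm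
    have e1 : (fun x : Λ => glue Λ (fun x => t x) s x) = fun x : Λ => t x :=
      funext fun x => by rw [glue_of_mem x.2]
    have e2 : (fun x : Λ' => glue Λ (fun x => t x) s x) = fun x : Λ' => s x :=
      funext fun x => by rw [glue_of_notMem fun h => hd' x h x.2]
    rw [embed_apply, embed_apply, if_pos h1, e1, e2]
    have : (∀ x, x ∉ Λ' → glue Λ (fun x => t x) s x = t x) ↔
        ∀ x, x ∉ Λ → x ∉ Λ' → s x = t x := by
      constructor
      · intro h x hx hx'
        rw [← h x hx', glue_of_notMem hx]
      · intro h x hx'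
        by_cases hx : x ∈ Λ
        · rw [glue_of_mem hx]
        · rw [glue_of_notMem hx, h x hx hx']
    by_cases h : ∀ x, x ∉ Λ → x ∉ Λ' → s x = t x
    · rw [if_pos h, if_pos (this.2 h)]
    · rw [if_neg h, if_neg fun h' => h (this.1 h'), mul_zero]
  · intro u _ hu
    rw [embed_apply, embed_apply]
    split_ifs with h1 h2
    · refine absurd (funext fun x => ?_) hu
      by_cases hx : x ∈ Λ
      · rw [glue_of_mem hx, h2 x (hd' x hx)]
      · rw [glue_of_notMem hx, h1 x hx]
    all_goals simp
  · intro h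
    exact absurd (Finset.mem_univ _) h

theorem ActsOn.commute {Λ Λ' : Finset (Fin n)} (hd : Disjoint Λ Λ') {Y Z : Op n q}
    (hY : ActsOn Λ Y) (hZ : ActsOn Λ' Z) : Commute Y Z := by
  classical
  obtain ⟨X, rfl⟩ := hY
  obtain ⟨X', rfl⟩ := hZ
  ext s t
  rw [embed_mul_embed_of_disjoint hd, embed_mul_embed_of_disjoint hd.symm, mul_comm]
  congr 1
  exact propext ⟨fun h x a b => h x b a, fun h x a b => h x b a⟩

theorem ActsOn.one (Λ : Finset (Fin n)) : ActsOn Λ (1 : Op n q) := ⟨1, (embed_one Λ).symm⟩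

theorem ActsOn.add {Λ : Finset (Fin n)} {Y Z : Op n q} (hY : ActsOn Λ Y) (hZ : ActsOn Λ Z) :
    ActsOn Λ (Y + Z) := by
  obtain ⟨X, rfl⟩ := hY
  obtain ⟨X', rfl⟩ := hZ
  exact ⟨X + X', (embed_add Λ X X').symm⟩

theorem ActsOn.smul {Λ : Finset (Fin n)} {Y : Op n q} (c : ℂ) (hY : ActsOn Λ Y) :
    ActsOn Λ (c • Y) := by
  obtain ⟨X, rfl⟩ := hY
  exact ⟨c • X, (embed_smul Λ c X).symm⟩

theorem ActsOn.mul {Λ : Finset (Fin n)} {Y Z : Op n q} (hY : ActsOn Λ Y) (hZ : ActsOn Λ Z) :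
    ActsOn Λ (Y * Z) := by
  obtain ⟨X, rfl⟩ := hY
  obtain ⟨X', rfl⟩ := hZ
  exact ⟨X * X', (embed_mul Λ X X').symm⟩

theorem ActsOn.conjTranspose {Λ : Finset (Fin n)} {Y : Op n q} (hY : ActsOn Λ Y) :
    ActsOn Λ Y.conjTranspose := by
  obtain ⟨X, rfl⟩ := hY
  exact ⟨X.conjTranspose, (embed_conjTranspose Λ X).symm⟩

theorem ActsOn.mono {Λ Λ' : Finset (Fin n)} (hs : Λ ⊆ Λ') {Y : Op n q} (hY : ActsOn Λ Y) :
    ActsOn Λ' Y := by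
  classical
  obtain ⟨X, rfl⟩ := hY
  refine ⟨fun a b => if ∀ x : Λ', (x : Fin n) ∉ Λ → a x = b x then
    X (fun x => a ⟨x, hs x.2⟩) (fun x => b ⟨x, hs x.2⟩) else 0, ?_⟩
  ext s t
  refine (embed_apply Λ X s t).trans (Eq.trans ?_ (embed_apply Λ' _ s t).symm)
  by_cases h : ∀ x, x ∉ Λ → s x = t x
  · rw [if_pos h, if_pos fun x hx => h x fun h' => hx (hs h')]
    have h' : ∀ x : Λ', (x : Fin n) ∉ Λ → s x = t x := fun x hx => h x hx
    exact (if_pos h').symm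
  · rw [if_neg h]
    split_ifs with h1 h2
    · refine absurd (fun x hx => ?_) h
      by_cases hx' : x ∈ Λ'
      · exact h2 ⟨x, hx'⟩ hx
      · exact h1 x hx'
    · rfl
    · rfl

theorem ActsOn.listProd {Λ : Finset (Fin n)} {l : List (Op n q)} (h : ∀ Y ∈ l, ActsOn Λ Y) :
    ActsOn Λ l.prod := by
  induction l with
  | nil => simpa using ActsOn.one Λ
  | cons a l ih =>
    rw [List.prod_cons]
    exact (h a (by simp)).mul (ih fun Y hY => h Y (by simp [hY]))

theorem IsObservableOn.actsOn {Λ : Finset (Fin n)} {Y : Op n q} (hY : IsObservableOn Λ Y) :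
    ActsOn Λ Y := by
  obtain ⟨X, -, rfl⟩ := hY
  exact ⟨X, rfl⟩

theorem IsObservableOn.isHermitian {Λ : Finset (Fin n)} {Y : Op n q} (hY : IsObservableOn Λ Y) :
    Y.IsHermitian := by
  obtain ⟨X, hX, rfl⟩ := hY
  rw [Matrix.IsHermitian, ← embed_conjTranspose, hX]

/-- Passing to the Hermitian part of the local matrix avoids injectivity of `embed`, which can fail
for `q = 0`. -/
theorem ActsOn.isObservableOn {Λ : Finset (Fin n)} {Y : Op n q} (hY : ActsOn Λ Y)
    (hH : Y.IsHermitian) : IsObservableOn Λ Y := by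
  obtain ⟨X, rfl⟩ := hY
  refine ⟨(2⁻¹ : ℂ) • (X + X.conjTranspose), ?_, ?_⟩
  · rw [Matrix.IsHermitian, Matrix.conjTranspose_smul, Matrix.conjTranspose_add,
      Matrix.conjTranspose_conjTranspose, add_comm]
    congr 1
    simp
  · rw [embed_smul, embed_add, embed_conjTranspose, hH, ← two_smul ℂ, smul_smul]
    norm_num

/-- An operator that acts on no spins is a multiple of the identity. -/
theorem ActsOn.eq_smul_one {Y : Op n q} (hY : ActsOn ∅ Y) : ∃ c : ℂ, Y = c • (1 : Op n q) := by
  obtain ⟨X, rfl⟩ := hY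
  refine ⟨X (fun x => (Finset.notMem_empty _ x.2).elim)
    (fun x => (Finset.notMem_empty _ x.2).elim), ?_⟩
  rw [← embed_one ∅, ← embed_smul]
  congr 1
  ext a b
  have : a = b := funext fun x => (Finset.notMem_empty _ x.2).elim
  subst this
  rw [Matrix.smul_apply, Matrix.one_apply_eq, smul_eq_mul, mul_one]
  congr 1 <;> exact funext fun x => (Finset.notMem_empty _ x.2).elim

theorem opNorm_add_le (X Y : Op n q) : opNorm (X + Y) ≤ opNorm X + opNorm Y := by
  simpa [opNorm] using norm_add_le (Matrix.toEuclideanCLM (𝕜 := ℂ) X) _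

theorem opNorm_sum_le {ι : Type*} (s : Finset ι) (f : ι → Op n q) :
    opNorm (∑ i ∈ s, f i) ≤ ∑ i ∈ s, opNorm (f i) := by
  simpa [opNorm] using norm_sum_le s fun i => Matrix.toEuclideanCLM (𝕜 := ℂ) (f i)

theorem opNorm_mul_le (X Y : Op n q) : opNorm (X * Y) ≤ opNorm X * opNorm Y := by
  simpa [opNorm] using norm_mul_le (Matrix.toEuclideanCLM (𝕜 := ℂ) X) _

theorem opNorm_smul (c : ℂ) (X : Op n q) : opNorm (c • X) = ‖c‖ * opNorm X := by
  simp [opNorm, norm_smul]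

theorem opNorm_conjTranspose (X : Op n q) : opNorm X.conjTranspose = opNorm X := by
  unfold opNorm
  rw [← Matrix.star_eq_conjTranspose, map_star, ContinuousLinearMap.star_eq_adjoint,
    LinearIsometryEquiv.norm_map]

theorem opNorm_one_le : opNorm (1 : Op n q) ≤ 1 := by
  unfold opNorm
  rw [map_one]
  exact ContinuousLinearMap.norm_id_le

theorem opNorm_listProd_ofFn_le {p : ℕ} (f : Fin p → Op n q) :
    opNorm (List.ofFn f).prod ≤ ∏ i, opNorm (f i) := by
  induction p with
  | zero => simpa using opNorm_one_le
  | succ p ih =>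
    rw [List.ofFn_succ, List.prod_cons, Fin.prod_univ_succ]
    exact (opNorm_mul_le _ _).trans (mul_le_mul_of_nonneg_left (ih _) (opNorm_nonneg _))

/-- Brings an isolated factor to the front; the `1` left in its place keeps the indexing of the
other factors. -/
theorem listProd_ofFn_eq_mul_update {M : Type*} [Monoid M] {p : ℕ} (f : Fin p → M) (j : Fin p)
    (hc : ∀ i, Commute (f j) (f i)) :
    (List.ofFn f).prod = f j * (List.ofFn (Function.update f j 1)).prod := by
  induction p with
  | zero => exact j.elim0
  | succ p ih =>
    rw [List.ofFn_succ, List.ofFn_succ, List.prod_cons, List.prod_cons]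
    cases j using Fin.cases with
    | zero =>
      simp
    | succ j =>
      have : (fun i : Fin p => Function.update f j.succ 1 i.succ) =
          Function.update (fun i : Fin p => f i.succ) j 1 := by
        funext i
        by_cases h : i = j
        · subst h; simp
        · simp [Function.update_of_ne h, Function.update_of_ne (fun h' => h (Fin.succ_injective _ h'))]
      rw [this, ih (fun i => f i.succ) j fun i => hc _, Function.update_of_ne (Fin.succ_ne_zero j).symm,
        ← mul_assoc, ← mul_assoc, (hc 0).eq]

end SpinSystem
end

/-! ### Functional calculus in the eigenbasis, and trace inequalities for states -/

noncomputable section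
namespace SpinSystem
variable {n q : ℕ}
open scoped ComplexOrder

/-- Conjugation of a real diagonal matrix by the eigenvector basis of a Hermitian matrix. -/
def eigenFn {H : Op n q} (hH : H.IsHermitian) (f : Config n q → ℝ) : Op n q :=
  (hH.eigenvectorUnitary : Op n q) * Matrix.diagonal (fun i => (f i : ℂ)) *
    star (hH.eigenvectorUnitary : Op n q)

variable {H : Op n q} (hH : H.IsHermitian)

theorem eigenFn_eigenvalues : eigenFn hH hH.eigenvalues = H := by
  conv_rhs => rw [hH.spectral_theorem, Unitary.conjStarAlgAut_apply]
  rfl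

theorem trace_eigenFn_mul (f : Config n q → ℝ) (X : Op n q) :
    (eigenFn hH f * X).trace = ∑ i, (f i : ℂ) *
      (star (hH.eigenvectorUnitary : Op n q) * X * (hH.eigenvectorUnitary : Op n q)) i i := by
  rw [eigenFn, Matrix.mul_assoc, Matrix.mul_assoc, Matrix.trace_mul_comm, Matrix.mul_assoc,
    Matrix.trace]
  refine Finset.sum_congr rfl fun i _ => ?_
  rw [Matrix.diag_apply, Matrix.diagonal_mul]

theorem trace_eigenFn (f : Config n q → ℝ) : (eigenFn hH f).trace = ∑ i, (f i : ℂ) := by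
  have := trace_eigenFn_mul hH f 1
  rw [mul_one, mul_one, Unitary.coe_star_mul_self] at this
  simpa using this

theorem eigenFn_sub (f g : Config n q → ℝ) :
    eigenFn hH (f - g) = eigenFn hH f - eigenFn hH g := by
  simp only [eigenFn, ← sub_mul, ← mul_sub, Matrix.diagonal_sub]
  simp

theorem eigenFn_smul (c : ℝ) (f : Config n q → ℝ) :
    eigenFn hH (c • f) = (c : ℂ) • eigenFn hH f := by
  have : (fun i => ((c • f) i : ℂ)) = (c : ℂ) • fun i => (f i : ℂ) := by
    funext i; simp
  rw [eigenFn, eigenFn, this, Matrix.diagonal_smul, mul_smul_comm, smul_mul_assoc]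

theorem eigenFn_mul (f g : Config n q → ℝ) :
    eigenFn hH (f * g) = eigenFn hH f * eigenFn hH g := by
  have : (fun i => ((f * g) i : ℂ)) = fun i => (f i : ℂ) * (g i : ℂ) := by
    funext i; simp
  rw [eigenFn, this, ← Matrix.diagonal_mul_diagonal]
  simp only [eigenFn, Matrix.mul_assoc]
  rw [← Matrix.mul_assoc (star (hH.eigenvectorUnitary : Op n q)) (hH.eigenvectorUnitary : Op n q),
    Unitary.coe_star_mul_self, Matrix.one_mul]

theorem eigenFn_one : eigenFn hH 1 = 1 := by
  have : (fun i : Config n q => (((1 : Config n q → ℝ) i : ℝ) : ℂ)) = 1 := by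
    funext i; simp
  rw [eigenFn, this]
  simp

theorem eigenFn_pow (f : Config n q → ℝ) (m : ℕ) :
    eigenFn hH (f ^ m) = eigenFn hH f ^ m := by
  induction m with
  | zero => rw [pow_zero, pow_zero, eigenFn_one]
  | succ m ih => rw [pow_succ, pow_succ, eigenFn_mul, ih]

theorem posSemidef_eigenFn {f : Config n q → ℝ} (hf : ∀ i, 0 ≤ f i) :
    (eigenFn hH f).PosSemidef := by
  rw [eigenFn, Matrix.star_eq_conjTranspose]
  refine Matrix.PosSemidef.mul_mul_conjTranspose_same ?_ _
  exact Matrix.PosSemidef.diagonal fun i => by simpa using hf i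

theorem eigenFn_exp (b : ℝ) : NormedSpace.exp ((b : ℂ) • H) =
    eigenFn hH (fun i => Real.exp (b * hH.eigenvalues i)) := by
  have hU : (hH.eigenvectorUnitary : Op n q)⁻¹ = star (hH.eigenvectorUnitary : Op n q) :=
    Matrix.inv_eq_left_inv (Unitary.coe_star_mul_self _)
  have hu : IsUnit (hH.eigenvectorUnitary : Op n q) :=
    ⟨Unitary.toUnits hH.eigenvectorUnitary, rfl⟩
  conv_lhs => rw [← eigenFn_eigenvalues hH, ← eigenFn_smul, eigenFn, ← hU]
  rw [Matrix.exp_conj _ _ hu, Matrix.exp_diagonal, hU, eigenFn]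
  congr 3
  funext i
  rw [Pi.coe_exp]
  simp [Complex.exp_eq_exp_ℂ]

theorem toEuclideanCLM_eigenFn_apply (f : Config n q → ℝ) (i : Config n q) :
    Matrix.toEuclideanCLM (𝕜 := ℂ) (eigenFn hH f) (hH.eigenvectorBasis i) =
      (f i : ℂ) • hH.eigenvectorBasis i := by
  apply (WithLp.ofLp_injective 2)
  rw [Matrix.ofLp_toEuclideanCLM, eigenFn, ← Matrix.mulVec_mulVec, ← Matrix.mulVec_mulVec,
    hH.star_eigenvectorUnitary_mulVec, Matrix.diagonal_mulVec_single, mul_one,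
    WithLp.ofLp_smul, ← hH.eigenvectorUnitary_mulVec, ← Matrix.mulVec_smul]
  congr 1
  rw [← Pi.single_smul]; simp

open Classical in
-- Both sides act alike on the eigenvector basis: a basis vector with eigenvalue in the shell lies
-- in the span, and any other is orthogonal to it because eigenvectors of a self-adjoint operator
-- for different eigenvalues are orthogonal.
theorem shellProjector_eq (E Δ : ℝ) : shellProjector H E Δ = eigenFn hH
    (fun i => if E - Δ < hH.eigenvalues i ∧ hH.eigenvalues i ≤ E then 1 else 0) := by
  set f : Config n q → ℝ :=
    fun i => if E - Δ < hH.eigenvalues i ∧ hH.eigenvalues i ≤ E then 1 else 0 with hf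
  rw [shellProjector, StarAlgEquiv.symm_apply_eq]
  have hHb : ∀ i, Matrix.toEuclideanCLM (𝕜 := ℂ) H (hH.eigenvectorBasis i) =
      (hH.eigenvalues i : ℂ) • hH.eigenvectorBasis i := fun i => by
    rw [← toEuclideanCLM_eigenFn_apply hH, eigenFn_eigenvalues]
  have hsymm : ∀ v w, inner ℂ (Matrix.toEuclideanCLM (𝕜 := ℂ) H v) w =
      inner ℂ v (Matrix.toEuclideanCLM (𝕜 := ℂ) H w) := fun v w => by
    have h1 : star (Matrix.toEuclideanCLM (𝕜 := ℂ) H) = Matrix.toEuclideanCLM (𝕜 := ℂ) H := by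
      rw [← map_star, Matrix.star_eq_conjTranspose, hH]
    conv_lhs => rw [← h1, ContinuousLinearMap.star_eq_adjoint,
      ContinuousLinearMap.adjoint_inner_left]
  have key : ∀ i, (shellSubspace H E Δ).starProjection (hH.eigenvectorBasis i) =
      (f i : ℂ) • hH.eigenvectorBasis i := by
    intro i
    symm
    by_cases hi : E - Δ < hH.eigenvalues i ∧ hH.eigenvalues i ≤ E
    · have : f i = 1 := by simp [hf, hi]
      rw [this, Complex.ofReal_one, one_smul]
      symm
      rw [Submodule.starProjection_eq_self_iff]
      exact Submodule.subset_span ⟨_, hi.1, hi.2, hHb i⟩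
    · have : f i = 0 := by simp only [hf, if_neg hi]
      rw [this, Complex.ofReal_zero, zero_smul]
      symm
      rw [Submodule.starProjection_apply_eq_zero_iff, Submodule.mem_orthogonal]
      intro u hu
      induction hu using Submodule.span_induction with
      | mem v hv =>
        obtain ⟨μ, h1, h2, h3⟩ := hv
        have h4 := hsymm v (hH.eigenvectorBasis i)
        rw [h3, hHb, inner_smul_left, inner_smul_right, Complex.conj_ofReal] at h4
        by_contra h5
        have h6 : μ = hH.eigenvalues i := by exact_mod_cast mul_right_cancel₀ h5 h4
        exact hi (h6 ▸ ⟨h1, h2⟩)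
      | zero => simp
      | add x y _ _ hx hy => rw [inner_add_left, hx, hy, add_zero]
      | smul c x _ hx => rw [inner_smul_left, hx, mul_zero]
  apply ContinuousLinearMap.coe_injective
  refine hH.eigenvectorBasis.toBasis.ext fun i => ?_
  simp only [OrthonormalBasis.coe_toBasis, ContinuousLinearMap.coe_coe]
  rw [key, toEuclideanCLM_eigenFn_apply]

/-- By cyclicity the trace is that of `A X A`. With `X = K ω - ρ` and `A = S ^ m` it transfers even
moments from `ω` to `ρ`. -/
theorem PosSemidef.re_trace_mul_self_nonneg {X A : Op n q} (hX : X.PosSemidef)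
    (hA : A.IsHermitian) : 0 ≤ (X * (A * A)).trace.re := by
  have h := hX.conjTranspose_mul_mul_same A
  rw [hA] at h
  have h2 := h.trace_nonneg
  rw [Matrix.mul_assoc, Matrix.trace_mul_comm, Matrix.mul_assoc] at h2
  exact (Complex.le_def.1 h2).1

theorem norm_apply_self_le_opNorm (X : Op n q) (i : Config n q) : ‖X i i‖ ≤ opNorm X := by
  have h1 : X i i = inner ℂ (EuclideanSpace.single i (1 : ℂ))
      (Matrix.toEuclideanCLM (𝕜 := ℂ) X (EuclideanSpace.single i 1)) := by
    rw [EuclideanSpace.inner_single_left, map_one, one_mul, Matrix.ofLp_toEuclideanCLM]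
    simp
  rw [h1]
  refine (norm_inner_le_norm _ _).trans ?_
  rw [PiLp.norm_single, norm_one, one_mul]
  refine (ContinuousLinearMap.le_opNorm _ _).trans ?_
  rw [PiLp.norm_single, norm_one, mul_one]
  rfl

theorem opNorm_unitary_le (U : Matrix.unitaryGroup (Config n q) ℂ) : opNorm (U : Op n q) ≤ 1 := by
  have h : opNorm (star (U : Op n q) * (U : Op n q)) = opNorm (U : Op n q) * opNorm (U : Op n q) := by
    unfold opNorm
    rw [map_mul, map_star, ContinuousLinearMap.star_eq_adjoint]
    exact ContinuousLinearMap.norm_adjoint_comp_self _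
  rw [Unitary.coe_star_mul_self] at h
  nlinarith [opNorm_one_le (n := n) (q := q), opNorm_nonneg (U : Op n q)]

/-- In the eigenbasis of `ρ` the trace is a convex combination of diagonal entries of a unitary
conjugate of `Y`. -/
theorem norm_trace_mul_le {ρ : Op n q} (hρ : ρ.PosSemidef) (ht : ρ.trace = 1) (Y : Op n q) :
    ‖(ρ * Y).trace‖ ≤ opNorm Y := by
  have hH := hρ.isHermitian
  have h1 : ∑ i, hH.eigenvalues i = 1 := by
    have := trace_eigenFn hH hH.eigenvalues
    rw [eigenFn_eigenvalues, ht] at this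
    exact_mod_cast this.symm
  have hU := opNorm_unitary_le hH.eigenvectorUnitary
  have hU' : opNorm (star (hH.eigenvectorUnitary : Op n q)) ≤ 1 := by
    rw [Matrix.star_eq_conjTranspose, opNorm_conjTranspose]; exact hU
  have h2 : opNorm (star (hH.eigenvectorUnitary : Op n q) * Y * (hH.eigenvectorUnitary : Op n q))
      ≤ opNorm Y := by
    refine (opNorm_mul_le _ _).trans ((mul_le_of_le_one_right (opNorm_nonneg _) hU).trans ?_)
    exact (opNorm_mul_le _ _).trans (mul_le_of_le_one_left (opNorm_nonneg _) hU')
  have h3 : (ρ * Y).trace = (eigenFn hH hH.eigenvalues * Y).trace := by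
    rw [eigenFn_eigenvalues]
  rw [h3, trace_eigenFn_mul]
  calc _ ≤ ∑ i, hH.eigenvalues i * opNorm Y := by
        refine (norm_sum_le _ _).trans (Finset.sum_le_sum fun i _ => ?_)
        rw [norm_mul, Complex.norm_real, Real.norm_of_nonneg (hρ.eigenvalues_nonneg i)]
        exact mul_le_mul_of_nonneg_left ((norm_apply_self_le_opNorm _ i).trans h2)
          (hρ.eigenvalues_nonneg i)
    _ = opNorm Y := by rw [← Finset.sum_mul, h1, one_mul]

/-- Jensen's inequality for even powers of an observable in a state. -/
theorem re_trace_mul_pow_le {ρ O : Op n q} (hρ : ρ.PosSemidef) (ht : ρ.trace = 1)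
    (hO : O.IsHermitian) (m : ℕ) :
    (ρ * O).trace.re ^ (2 * m) ≤ (ρ * O ^ (2 * m)).trace.re := by
  -- The diagonal of `ρ` in the eigenbasis of `O` is a probability distribution, so the scalar
  -- Jensen inequality applies to the eigenvalues of `O`.
  set p : Config n q → ℂ := fun i =>
    (star (hO.eigenvectorUnitary : Op n q) * ρ * (hO.eigenvectorUnitary : Op n q)) i i with hp
  have hpp : ∀ i, 0 ≤ p i := fun i =>
    (hρ.conjTranspose_mul_mul_same (hO.eigenvectorUnitary : Op n q)).diag_nonneg
  have hpi : ∀ i, 0 ≤ (p i).re := fun i => (Complex.le_def.1 (hpp i)).1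
  have hf : ∀ f : Config n q → ℝ, (eigenFn hO f * ρ).trace.re = ∑ i, (p i).re * f i := by
    intro f
    rw [trace_eigenFn_mul, Complex.re_sum]
    exact Finset.sum_congr rfl fun i _ => by rw [Complex.re_ofReal_mul, mul_comm]
  have h1 : ∑ i, (p i).re = 1 := by
    have := hf 1
    rw [eigenFn_one, one_mul, ht] at this
    simpa using this.symm
  have hO1 := hf hO.eigenvalues
  have hO2 := hf (hO.eigenvalues ^ (2 * m))
  rw [eigenFn_pow] at hO2
  rw [eigenFn_eigenvalues] at hO1 hO2
  rw [Matrix.trace_mul_comm, Matrix.trace_mul_comm ρ, hO1, hO2]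
  exact Real.pow_arith_mean_le_arith_mean_pow_of_even _ _ _ (fun i _ => hpi i) h1
    (even_two_mul m)

end SpinSystem
end

/-! ### Energy shells, the partition function and domination by the Gibbs state -/

noncomputable section
namespace SpinSystem
variable {n q : ℕ}
open scoped ComplexOrder

/-- Windows with right ends `a + jΔ` cover `[a, a + T]`. The Boltzmann factor varies by at most `exp
(β * Δ)` inside a window, so each contributes at most `exp (β * Δ) * G`. -/
theorem sum_exp_le_of_windows {ι : Type*} [Fintype ι] (lam : ι → ℝ) {β Δ T a G Z : ℝ}
    (hβ : 0 ≤ β) (hΔ : 0 < Δ) (hT : 0 ≤ T) (ha : ∀ i, a ≤ lam i)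
    (hZ : Z ≤ 2 * ∑ i with lam i ≤ a + T, Real.exp (-β * lam i))
    (hG : ∀ E : ℝ, Real.exp (-β * E) * ((Finset.univ.filter
      fun i => E - Δ < lam i ∧ lam i ≤ E).card : ℝ) ≤ G) :
    Z ≤ 2 * Real.exp (β * Δ) * (T / Δ + 2) * G := by
  have hG0 : 0 ≤ G := (by positivity : (0 : ℝ) ≤ _).trans (hG 0)
  -- The ceiling matches windows that are open on the left and closed on the right. The value `0`
  -- occurs at `lam i = a`, hence the extra window.
  have hmaps : ∀ i ∈ Finset.univ.filter (fun i => lam i ≤ a + T),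
      ⌈(lam i - a) / Δ⌉₊ ∈ Finset.range (⌈T / Δ⌉₊ + 1) := by
    intro i hi
    rw [Finset.mem_filter] at hi
    rw [Finset.mem_range, Nat.lt_succ_iff]
    exact Nat.ceil_mono (by gcongr; linarith [hi.2])
  have hfib : ∀ j : ℕ, ∑ i ∈ Finset.univ.filter (fun i => lam i ≤ a + T) with
      ⌈(lam i - a) / Δ⌉₊ = j, Real.exp (-β * lam i) ≤ Real.exp (β * Δ) * G := by
    intro j
    set E := a + j * Δ with hE
    have hw : ∀ i, ⌈(lam i - a) / Δ⌉₊ = j → E - Δ < lam i ∧ lam i ≤ E := by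
      intro i hi
      have h0 : 0 ≤ (lam i - a) / Δ := div_nonneg (by linarith [ha i]) hΔ.le
      have h1 := Nat.le_ceil ((lam i - a) / Δ)
      have h2 := Nat.ceil_lt_add_one h0
      rw [hi] at h1 h2
      rw [div_le_iff₀ hΔ] at h1
      have h3 : ((j : ℝ) - 1) * Δ < lam i - a := by
        rw [← lt_div_iff₀ hΔ]; linarith
      constructor <;> nlinarith
    calc _ ≤ ∑ i with E - Δ < lam i ∧ lam i ≤ E, Real.exp (-β * lam i) := by
          refine Finset.sum_le_sum_of_subset_of_nonneg ?_ fun _ _ _ => (Real.exp_pos _).le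
          intro i hi
          rw [Finset.mem_filter] at hi ⊢
          exact ⟨Finset.mem_univ _, hw i hi.2⟩
      _ ≤ ∑ i with E - Δ < lam i ∧ lam i ≤ E, Real.exp (β * Δ) * Real.exp (-β * E) := by
          refine Finset.sum_le_sum fun i hi => ?_
          rw [Finset.mem_filter] at hi
          rw [← Real.exp_add, Real.exp_le_exp]
          nlinarith [hi.2.1]
      _ = Real.exp (β * Δ) * (Real.exp (-β * E) * ((Finset.univ.filter
            fun i => E - Δ < lam i ∧ lam i ≤ E).card : ℝ)) := by
          rw [Finset.sum_const, nsmul_eq_mul]; ring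
      _ ≤ _ := mul_le_mul_of_nonneg_left (hG E) (Real.exp_pos _).le
  have hceil : ((⌈T / Δ⌉₊ + 1 : ℕ) : ℝ) ≤ T / Δ + 2 := by
    push_cast
    linarith [Nat.ceil_lt_add_one (div_nonneg hT hΔ.le)]
  calc Z ≤ 2 * ∑ i with lam i ≤ a + T, Real.exp (-β * lam i) := hZ
    _ ≤ 2 * ∑ j ∈ Finset.range (⌈T / Δ⌉₊ + 1), Real.exp (β * Δ) * G := by
        rw [← Finset.sum_fiberwise_of_maps_to hmaps]
        gcongr with j
        exact hfib j
    _ = 2 * (((⌈T / Δ⌉₊ + 1 : ℕ) : ℝ) * (Real.exp (β * Δ) * G)) := by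
        rw [Finset.sum_const, Finset.card_range, nsmul_eq_mul]
    _ ≤ 2 * ((T / Δ + 2) * (Real.exp (β * Δ) * G)) := by gcongr
    _ = _ := by ring

/-- For positive inverse temperature, the eigenvalues far above the ground state energy make up
at most half of the partition function. -/
theorem sum_exp_le_two_mul_sum_low {ι : Type*} [Fintype ι] [Nonempty ι] (lam : ι → ℝ)
    {β a T : ℝ} (ha : ∃ i, lam i = a)
    (hT : Real.log 2 + Real.log (Fintype.card ι) ≤ β * T) (hβ : 0 ≤ β) :
    ∑ i, Real.exp (-β * lam i) ≤ 2 * ∑ i with lam i ≤ a + T, Real.exp (-β * lam i) := by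
  have hc : (0 : ℝ) < Fintype.card ι := by exact_mod_cast Fintype.card_pos
  have hT' : Real.exp (-β * T) * Fintype.card ι ≤ 1 / 2 := by
    rw [← Real.log_mul (by norm_num) hc.ne', Real.log_le_iff_le_exp (by positivity)] at hT
    rw [neg_mul, Real.exp_neg, inv_mul_le_iff₀ (Real.exp_pos _)]
    linarith
  -- Even if all eigenvalues were high, their total would be at most half the weight of the ground
  -- state.
  have hhigh : ∑ i with ¬ lam i ≤ a + T, Real.exp (-β * lam i) ≤ 1 / 2 * Real.exp (-β * a) := by
    calc _ ≤ ∑ i with ¬ lam i ≤ a + T, Real.exp (-β * T) * Real.exp (-β * a) := by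
          refine Finset.sum_le_sum fun i hi => ?_
          rw [Finset.mem_filter, not_le] at hi
          rw [← Real.exp_add, Real.exp_le_exp]
          nlinarith [hi.2]
      _ ≤ ∑ i, Real.exp (-β * T) * Real.exp (-β * a) :=
          Finset.sum_le_sum_of_subset_of_nonneg (Finset.subset_univ _) fun _ _ _ => by positivity
      _ = (Real.exp (-β * T) * Fintype.card ι) * Real.exp (-β * a) := by
          rw [Finset.sum_const, nsmul_eq_mul, Finset.card_univ]; ring
      _ ≤ _ := by gcongr
  have hground : Real.exp (-β * a) ≤ ∑ i, Real.exp (-β * lam i) := by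
    obtain ⟨i, rfl⟩ := ha
    exact Finset.single_le_sum (f := fun i => Real.exp (-β * lam i))
      (fun _ _ => (Real.exp_pos _).le) (Finset.mem_univ i)
  have := Finset.sum_filter_add_sum_filter_not Finset.univ (fun i => lam i ≤ a + T)
    fun i => Real.exp (-β * lam i)
  linarith

variable {H : Op n q} (hH : H.IsHermitian)

/-- The partition function. -/
def partition (β : ℝ) : ℝ := ∑ i, Real.exp (-β * hH.eigenvalues i)

theorem gibbsState_eq (β : ℝ) : gibbsState β H =
    eigenFn hH (fun i => (partition hH β)⁻¹ * Real.exp (-β * hH.eigenvalues i)) := by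
  have h1 := eigenFn_exp hH (-β)
  rw [Complex.ofReal_neg] at h1
  have h2 : (fun i => (partition hH β)⁻¹ * Real.exp (-β * hH.eigenvalues i)) =
    (partition hH β)⁻¹ • fun i => Real.exp (-β * hH.eigenvalues i) := rfl
  rw [gibbsState, h1, trace_eigenFn, h2, eigenFn_smul]
  congr 1
  rw [partition]
  push_cast
  rfl

theorem partition_pos [Nonempty (Config n q)] (β : ℝ) : 0 < partition hH β :=
  Finset.sum_pos (fun _ _ => Real.exp_pos _) Finset.univ_nonempty

theorem posSemidef_gibbsState [Nonempty (Config n q)] (hH : H.IsHermitian) (β : ℝ) :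
    (gibbsState β H).PosSemidef := by
  rw [gibbsState_eq hH]
  exact posSemidef_eigenFn hH fun i =>
    mul_nonneg (inv_nonneg.2 (partition_pos hH β).le) (Real.exp_pos _).le

theorem trace_gibbsState [Nonempty (Config n q)] (hH : H.IsHermitian) (β : ℝ) :
    (gibbsState β H).trace = 1 := by
  rw [gibbsState_eq hH, trace_eigenFn, ← Complex.ofReal_sum, ← Finset.mul_sum]
  have := inv_mul_cancel₀ (partition_pos hH β).ne'
  exact_mod_cast this

/-- The number of eigenvalues in the energy shell. -/
def shellCard (E Δ : ℝ) : ℕ :=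
  (Finset.univ.filter fun i => E - Δ < hH.eigenvalues i ∧ hH.eigenvalues i ≤ E).card

theorem trace_shellProjector (E Δ : ℝ) :
    (shellProjector H E Δ).trace = (shellCard hH E Δ : ℝ) := by
  classical
  rw [shellProjector_eq hH, trace_eigenFn, ← Complex.ofReal_sum, Finset.sum_boole]
  rfl

open Classical in
theorem microcanonicalState_eq (E Δ : ℝ) : microcanonicalState H E Δ =
    eigenFn hH (fun i => (shellCard hH E Δ : ℝ)⁻¹ *
      if E - Δ < hH.eigenvalues i ∧ hH.eigenvalues i ≤ E then 1 else 0) := by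
  rw [microcanonicalState, trace_shellProjector hH, shellProjector_eq hH, ← Complex.ofReal_inv,
    ← eigenFn_smul]
  rfl

theorem posSemidef_microcanonicalState (hH : H.IsHermitian) (E Δ : ℝ) :
    (microcanonicalState H E Δ).PosSemidef := by
  classical
  rw [microcanonicalState_eq hH]
  exact posSemidef_eigenFn hH fun i => mul_nonneg (by positivity) (by split_ifs <;> norm_num)

theorem trace_microcanonicalState {E Δ : ℝ} (hN : 0 < shellCard hH E Δ) :
    (microcanonicalState H E Δ).trace = 1 := by
  rw [microcanonicalState, Matrix.trace_smul, trace_shellProjector hH, smul_eq_mul,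
    inv_mul_cancel₀]
  exact_mod_cast hN.ne'

/-- The comparison is between weights in the common eigenbasis. On the shell, `λ ≤ E` gives `exp (-β
* λ) ≥ exp (-β * E)`; off the shell the microcanonical weight is zero. -/
theorem posSemidef_smul_gibbsState_sub [Nonempty (Config n q)] {β E Δ K : ℝ} (hβ : 0 ≤ β)
    (hK : partition hH β ≤ K * (Real.exp (-β * E) * shellCard hH E Δ)) (hK0 : 0 ≤ K)
    (hN : 0 < shellCard hH E Δ) :
    ((K : ℂ) • gibbsState β H - microcanonicalState H E Δ).PosSemidef := by
  classical
  rw [gibbsState_eq hH, microcanonicalState_eq hH, ← eigenFn_smul, ← eigenFn_sub]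
  refine posSemidef_eigenFn hH fun i => ?_
  have hZ := partition_pos hH β
  have hN' : (0 : ℝ) < shellCard hH E Δ := by exact_mod_cast hN
  rw [Pi.sub_apply, Pi.smul_apply, smul_eq_mul, sub_nonneg]
  split_ifs with h
  · rw [mul_one, inv_le_iff_one_le_mul₀ hN', ← mul_assoc, mul_comm K, mul_assoc, mul_assoc,
      inv_mul_eq_div, le_div_iff₀ hZ, one_mul]
    refine hK.trans ?_
    refine mul_le_mul_of_nonneg_left (mul_le_mul_of_nonneg_right ?_ hN'.le) hK0
    rw [Real.exp_le_exp]
    nlinarith [h.2]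
  · rw [mul_zero]
    positivity

theorem exists_localDecomposition_of_localNorm_lt {O : Op n q} {a : ℝ} (hO : O.IsHermitian)
    (ha : localNorm O < 2 * a) : ∃ h : Finset (Fin n) → Op n q, IsLocalDecomposition O h ∧
      ∀ x : Fin n, ∑ Λ with x ∈ Λ, opNorm (h Λ) ≤ a := by
  obtain ⟨h₀, hh₀⟩ := exists_localDecomposition hO
  have hlt : sInf {m : ℝ | ∃ h : Finset (Fin n) → Op n q, IsLocalDecomposition O h ∧
      m = ⨆ x : Fin n, ∑ Λ with x ∈ Λ, opNorm (h Λ)} < a := by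
    unfold localNorm at ha; linarith
  obtain ⟨m, ⟨h, hh, rfl⟩, hm⟩ := exists_lt_of_csInf_lt (by exact ⟨_, h₀, hh₀, rfl⟩) hlt
  exact ⟨h, hh, fun x => (le_ciSup (f := fun x : Fin n => ∑ Λ with x ∈ Λ, opNorm (h Λ))
    (Set.finite_range _).bddAbove x).trans hm.le⟩

/-- Double counting of the pairs of a region and a spin in it. -/
theorem sum_card_mul_le {w : Finset (Fin n) → ℝ} {a : ℝ}
    (hw : ∀ x : Fin n, ∑ Λ with x ∈ Λ, w Λ ≤ a) : ∑ Λ, (Λ.card : ℝ) * w Λ ≤ n * a := by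
  classical
  calc ∑ Λ, (Λ.card : ℝ) * w Λ = ∑ x : Fin n, ∑ Λ with x ∈ Λ, w Λ := by
        simp_rw [Finset.sum_filter]
        rw [Finset.sum_comm]
        refine Finset.sum_congr rfl fun Λ _ => ?_
        rw [← Finset.sum_filter]
        simp
    _ ≤ _ := by
        refine (Finset.sum_le_sum fun x _ => hw x).trans ?_
        simp

theorem sum_nonempty_le {w : Finset (Fin n) → ℝ} {a : ℝ} (hw0 : ∀ Λ, 0 ≤ w Λ)
    (hw : ∀ x : Fin n, ∑ Λ with x ∈ Λ, w Λ ≤ a) : ∑ Λ with Λ ≠ ∅, w Λ ≤ n * a := by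
  refine le_trans ?_ (sum_card_mul_le hw)
  rw [Finset.sum_filter]
  refine Finset.sum_le_sum fun Λ _ => ?_
  split_ifs with h
  · have : (1 : ℝ) ≤ Λ.card := by
      exact_mod_cast (Finset.nonempty_iff_ne_empty.2 h).card_pos
    nlinarith [hw0 Λ]
  · have := hw0 Λ
    positivity

theorem norm_eigenvalues_sub_le (c : ℂ) (i : Config n q) :
    ‖(hH.eigenvalues i : ℂ) - c‖ ≤ opNorm (H - c • 1) := by
  have hb := hH.eigenvectorBasis.orthonormal.1 i
  have h1 : Matrix.toEuclideanCLM (𝕜 := ℂ) (H - c • 1) (hH.eigenvectorBasis i) =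
      ((hH.eigenvalues i : ℂ) - c) • hH.eigenvectorBasis i := by
    have h2 := toEuclideanCLM_eigenFn_apply hH hH.eigenvalues i
    rw [eigenFn_eigenvalues] at h2
    rw [map_sub, map_smul, map_one, sub_apply, h2, sub_smul]
    rfl
  have h3 := (Matrix.toEuclideanCLM (𝕜 := ℂ) (H - c • 1)).le_opNorm (hH.eigenvectorBasis i)
  rwa [h1, norm_smul, hb, mul_one, mul_one] at h3

/-- The term of the empty region is a scalar and only shifts the spectrum; the other terms have
total norm at most `n * (M + 1) / 2`. The `+ 1` is slack for a decomposition that need not attain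
the infimum. -/
theorem eigenvalues_sub_le {M : ℝ} (hM : localNorm H ≤ M) (i j : Config n q) :
    hH.eigenvalues i - hH.eigenvalues j ≤ n * (M + 1) := by
  classical
  obtain ⟨h, ⟨hobs, hsum⟩, hx⟩ := exists_localDecomposition_of_localNorm_lt (a := (M + 1) / 2) hH
    (by linarith)
  obtain ⟨c, hc⟩ := (hobs ∅).actsOn.eq_smul_one
  have h1 : opNorm (H - c • 1) ≤ n * ((M + 1) / 2) := by
    have : H - c • 1 = ∑ Λ with Λ ≠ ∅, h Λ := by
      rw [hsum, ← hc, Finset.filter_ne', ← Finset.add_sum_erase _ h (Finset.mem_univ ∅),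
        add_sub_cancel_left]
    rw [this]
    exact (opNorm_sum_le _ _).trans (sum_nonempty_le (fun _ => opNorm_nonneg _) hx)
  have h2 : ‖(hH.eigenvalues i : ℂ) - hH.eigenvalues j‖ ≤ n * (M + 1) := by
    have e : (hH.eigenvalues i : ℂ) - hH.eigenvalues j =
      ((hH.eigenvalues i : ℂ) - c) - ((hH.eigenvalues j : ℂ) - c) := by ring
    rw [e]
    refine (norm_sub_le _ _).trans ?_
    linarith [norm_eigenvalues_sub_le hH c i, norm_eigenvalues_sub_le hH c j]
  rw [← Complex.ofReal_sub, Complex.norm_real] at h2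
  exact (le_abs_self _).trans h2

/-- The energy range that determines, per spin, the number of relevant energy shells. -/
def energyRange (q : ℕ) (β M : ℝ) : ℝ :=
  if β = 0 then |M| + 1 else (Real.log 2 + Real.log q) / β

theorem energyRange_nonneg (q : ℕ) {β : ℝ} (M : ℝ) (hβ : 0 ≤ β) : 0 ≤ energyRange q β M := by
  unfold energyRange
  split_ifs
  · positivity
  · exact div_nonneg (add_nonneg (Real.log_nonneg (by norm_num)) (Real.log_natCast_nonneg q)) hβ

theorem partition_le [Nonempty (Config n q)] {β M Δ E : ℝ} (hn : 1 ≤ n) (hβ : 0 ≤ β)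
    (hM : β = 0 → localNorm H ≤ M) (hΔ : 0 < Δ) (hE : IsOptimalEnergy β H Δ E) :
    partition hH β ≤ 2 * Real.exp (β * Δ) * (energyRange q β M * n / Δ + 2) *
      (Real.exp (-β * E) * shellCard hH E Δ) := by
  classical
  obtain ⟨i₀, hi₀⟩ := Finite.exists_min hH.eigenvalues
  have hT0 := mul_nonneg (energyRange_nonneg q M hβ) (Nat.cast_nonneg n)
  refine sum_exp_le_of_windows hH.eigenvalues hβ hΔ hT0 hi₀ ?_ fun E' => ?_
  · rcases hβ.eq_or_lt with hβ0 | hβ0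
    · have hall : ∀ i, hH.eigenvalues i ≤ hH.eigenvalues i₀ + energyRange q β M * n := by
        intro i
        have := eigenvalues_sub_le hH (hM hβ0.symm) i i₀
        rw [energyRange, if_pos hβ0.symm]
        nlinarith [le_abs_self M, (Nat.cast_nonneg n : (0 : ℝ) ≤ n)]
      rw [Finset.filter_true_of_mem fun i _ => hall i]
      have := partition_pos hH β
      unfold partition at this ⊢
      linarith
    · refine sum_exp_le_two_mul_sum_low hH.eigenvalues ⟨i₀, rfl⟩ ?_ hβ
      have hn' : (1 : ℝ) ≤ n := by exact_mod_cast hn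
      have hq := Real.log_natCast_nonneg q
      have h2 := Real.log_nonneg (x := 2) (by norm_num)
      rw [energyRange, if_neg hβ0.ne', div_mul_eq_mul_div, mul_div_cancel₀ _ hβ0.ne']
      simp only [Fintype.card_fun, Fintype.card_fin, Nat.cast_pow, Real.log_pow]
      nlinarith
  · have := hE E'
    rw [trace_shellProjector hH, trace_shellProjector hH, Complex.ofReal_re,
      Complex.ofReal_re] at this
    exact this

theorem shellCard_pos [Nonempty (Config n q)] {β Δ E K : ℝ}
    (hK : partition hH β ≤ K * (Real.exp (-β * E) * shellCard hH E Δ)) :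
    0 < shellCard hH E Δ := by
  by_contra h
  have h0 : shellCard hH E Δ = 0 := by omega
  rw [h0, Nat.cast_zero, mul_zero, mul_zero] at hK
  exact absurd (partition_pos hH β) (not_lt.2 hK)

end SpinSystem
end

/-! ### Counting tuples without isolated entries; clustering beyond self-adjoint operators -/

noncomputable section
namespace SpinSystem

/-- A finite graph without isolated vertices has a set of at least half of the vertices, each of
which has a neighbour outside the set: a minimal dominating set or its complement. -/
theorem exists_half_with_neighbor_outside {ι : Type*} [Fintype ι] (R : ι → ι → Prop)
    (hsymm : ∀ i j, R i j → R j i) (hiso : ∀ j, ∃ i, i ≠ j ∧ R j i) :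
    ∃ S : Finset ι, Fintype.card ι ≤ 2 * S.card ∧ ∀ j ∈ S, ∃ i, i ∉ S ∧ R j i := by
  classical
  obtain ⟨T, hT⟩ := exists_minimal_of_wellFoundedLT
    (fun T : Finset ι => ∀ j, j ∉ T → ∃ i, i ∈ T ∧ R j i)
    ⟨Finset.univ, fun j hj => absurd (Finset.mem_univ j) hj⟩
  have hT2 : ∀ j ∈ T, ∃ i, i ∉ T ∧ R j i := by
    intro j hj
    by_contra! hcon
    -- If all neighbours of `j` lay in `T`, then `T.erase j` would still dominate: `j` has a
    -- neighbour in it, and no vertex outside `T` relied on `j`.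
    have hle : T ≤ T.erase j := by
      refine hT.2 (fun v hv => ?_) (Finset.erase_subset _ _)
      by_cases hvj : v = j
      · subst hvj
        obtain ⟨i, hi, hR⟩ := hiso v
        exact ⟨i, Finset.mem_erase.2 ⟨hi, by_contra fun h => hcon i h hR⟩, hR⟩
      · have hvT : v ∉ T := fun h => hv (Finset.mem_erase.2 ⟨hvj, h⟩)
        obtain ⟨i, hi, hR⟩ := hT.1 v hvT
        refine ⟨i, Finset.mem_erase.2 ⟨?_, hi⟩, hR⟩
        rintro rfl
        exact hcon v hvT (hsymm _ _ hR)
    exact Finset.notMem_erase j T (hle hj)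
  by_cases hc : Fintype.card ι ≤ 2 * T.card
  · exact ⟨T, hc, hT2⟩
  · refine ⟨Tᶜ, ?_, fun j hj => ?_⟩
    · rw [Finset.card_compl]
      have := Finset.card_le_univ T
      omega
    · obtain ⟨i, hi, hR⟩ := hT.1 j (Finset.mem_compl.1 hj)
      exact ⟨i, fun h => Finset.mem_compl.1 h hi, hR⟩

section

variable {α : Type*} [Fintype α] {w : α → ℝ} {R : α → α → Prop} [DecidableRel R] {W B : ℝ}

/-- Once the entries outside `S` are fixed, the entries in `S` decouple: each has at most `p`
choices of a neighbour, and weight at most `B` for each choice. -/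
theorem sum_prod_mul_prod_neighbors_le {p : ℕ} (S : Finset (Fin p)) (hw : ∀ a, 0 ≤ w a)
    (hW : ∑ a, w a ≤ W) (hB : ∀ b, ∑ a with R a b, w a ≤ B) (hB0 : 0 ≤ B) :
    ∑ x : Fin p → α, (∏ j, w (x j)) *
      ∏ j : {j // j ∈ S}, ∑ i : {i // i ∉ S}, (if R (x j) (x i) then (1 : ℝ) else 0) ≤
      W ^ (p - S.card) * (p * B) ^ S.card := by
  classical
  have hcS : Fintype.card {j // j ∈ S} = S.card := Fintype.card_coe S
  have hcS' : Fintype.card {j // j ∉ S} = p - S.card := by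
    rw [Fintype.card_subtype_compl, Fintype.card_fin, hcS]
  have hrow : ∀ z : {i // i ∉ S} → α,
      ∑ a, w a * ∑ i, (if R a (z i) then (1 : ℝ) else 0) ≤ p * B := by
    intro z
    calc _ = ∑ i, ∑ a with R a (z i), w a := by
          simp_rw [Finset.mul_sum, Finset.sum_filter]
          rw [Finset.sum_comm]
          simp
      _ ≤ ∑ i : {i // i ∉ S}, B := Finset.sum_le_sum fun i _ => hB _
      _ ≤ p * B := by
          rw [Finset.sum_const, nsmul_eq_mul, Finset.card_univ]
          have : Fintype.card {i // i ∉ S} ≤ p := by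
            rw [hcS']; exact Nat.sub_le _ _
          have : (Fintype.card {i // i ∉ S} : ℝ) ≤ p := by exact_mod_cast this
          exact mul_le_mul_of_nonneg_right this hB0
  have hrow0 : ∀ (z : {i // i ∉ S} → α) (a : α),
      0 ≤ w a * ∑ i, (if R a (z i) then (1 : ℝ) else 0) := fun z a =>
    mul_nonneg (hw a) (Finset.sum_nonneg fun i _ => by split_ifs <;> norm_num)
  rw [Fintype.sum_equiv (Equiv.piEquivPiSubtypeProd (fun j => j ∈ S) (fun _ => α)) _
    (fun yz : ({j // j ∈ S} → α) × ({i // i ∉ S} → α) => (∏ i, w (yz.2 i)) *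
      ∏ j, (w (yz.1 j) * ∑ i, (if R (yz.1 j) (yz.2 i) then (1 : ℝ) else 0)))]
  · rw [Fintype.sum_prod_type_right]
    calc _ = ∑ z : {i // i ∉ S} → α, (∏ i, w (z i)) * ∏ _j : {j // j ∈ S},
            ∑ a, w a * ∑ i, (if R a (z i) then (1 : ℝ) else 0) := by
          refine Finset.sum_congr rfl fun z _ => ?_
          dsimp only
          rw [← Finset.mul_sum, Finset.prod_univ_sum, Fintype.piFinset_univ]
      _ ≤ ∑ z : {i // i ∉ S} → α, (∏ i, w (z i)) * (p * B) ^ S.card := by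
          refine Finset.sum_le_sum fun z _ => ?_
          refine mul_le_mul_of_nonneg_left ?_ (Finset.prod_nonneg fun i _ => hw _)
          rw [Finset.prod_const, Finset.card_univ, hcS]
          exact pow_le_pow_left₀ (Finset.sum_nonneg fun a _ => hrow0 z a) (hrow z) _
      _ = (∏ _i : {i // i ∉ S}, ∑ a, w a) * (p * B) ^ S.card := by
          rw [Finset.prod_univ_sum, Fintype.piFinset_univ, Finset.sum_mul]
      _ ≤ _ := by
          rw [Finset.prod_const, Finset.card_univ, hcS']
          have h0 := Finset.sum_nonneg fun a (_ : a ∈ Finset.univ) => hw a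
          gcongr
  · intro x
    rw [Finset.prod_mul_distrib, ← mul_assoc]
    congr 1
    rw [mul_comm]
    convert (Fintype.prod_subtype_mul_prod_subtype (fun j => j ∈ S) fun j => w (x j)).symm <;> rfl

open Classical in
-- Each such tuple has a set `S` of at least `m` positions with neighbours outside `S`. The sum over
-- all `2 ^ (2 * m)` candidates for `S` costs the factor `4 ^ m`.
theorem sum_prod_nonisolated_le (m : ℕ) (hw : ∀ a, 0 ≤ w a)
    (hsymm : ∀ a b, R a b → R b a) (hW : ∑ a, w a ≤ W) (hB : ∀ b, ∑ a with R a b, w a ≤ B)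
    (hB0 : 0 ≤ B) (hBW : ((2 * m : ℕ) : ℝ) * B ≤ W) :
    ∑ x : Fin (2 * m) → α with ∀ j, ∃ i, i ≠ j ∧ R (x j) (x i), ∏ j, w (x j) ≤
      4 ^ m * (W * ((2 * m : ℕ) * B)) ^ m := by
  have hpB : 0 ≤ ((2 * m : ℕ) : ℝ) * B := by positivity
  have hW0 : 0 ≤ W := hpB.trans hBW
  set F : (Fin (2 * m) → α) → Finset (Fin (2 * m)) → ℝ := fun x S => (∏ j, w (x j)) *
      ∏ j : {j // j ∈ S}, ∑ i : {i // i ∉ S}, (if R (x j) (x i) then (1 : ℝ) else 0) with hF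
  have hprod : ∀ x : Fin (2 * m) → α, 0 ≤ ∏ j, w (x j) :=
    fun x => Finset.prod_nonneg fun j _ => hw _
  have hif : ∀ a b, (0 : ℝ) ≤ if R a b then (1 : ℝ) else 0 := fun a b => by
    split_ifs <;> norm_num
  have hF0 : ∀ x S, 0 ≤ F x S := fun x S => mul_nonneg (hprod x)
    (Finset.prod_nonneg fun j _ => Finset.sum_nonneg fun i _ => hif _ _)
  calc _ ≤ ∑ x : Fin (2 * m) → α with ∀ j, ∃ i, i ≠ j ∧ R (x j) (x i),
          ∑ S : Finset (Fin (2 * m)) with m ≤ S.card, F x S := by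
        refine Finset.sum_le_sum fun x hx => ?_
        obtain ⟨S, hS, hS2⟩ := exists_half_with_neighbor_outside (fun i j => R (x i) (x j))
          (fun i j => hsymm _ _) (Finset.mem_filter.1 hx).2
        rw [Fintype.card_fin] at hS
        refine le_trans ?_ (Finset.single_le_sum (f := F x) (fun S _ => hF0 x S)
          (Finset.mem_filter.2 ⟨Finset.mem_univ S, by omega⟩))
        refine le_mul_of_one_le_right (hprod x) ?_
        refine Finset.one_le_prod fun j _ => ?_
        obtain ⟨i, hi, hR⟩ := hS2 j j.2
        refine le_trans ?_ (Finset.single_le_sum (fun i _ => hif _ _)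
          (Finset.mem_univ (⟨i, hi⟩ : {i // i ∉ S})))
        rw [if_pos hR]
    _ ≤ ∑ x : Fin (2 * m) → α, ∑ S : Finset (Fin (2 * m)) with m ≤ S.card, F x S :=
        Finset.sum_le_sum_of_subset_of_nonneg (Finset.subset_univ _)
          fun x _ _ => Finset.sum_nonneg fun S _ => hF0 x S
    _ = ∑ S : Finset (Fin (2 * m)) with m ≤ S.card, ∑ x, F x S := Finset.sum_comm
    _ ≤ ∑ S : Finset (Fin (2 * m)) with m ≤ S.card, (W * ((2 * m : ℕ) * B)) ^ m := by
        refine Finset.sum_le_sum fun S hS => ?_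
        refine (sum_prod_mul_prod_neighbors_le S hw hW hB hB0).trans ?_
        -- The `k` surplus factors `2 * m * B` are each at most `W`, so `S.card = m` is the worst
        -- case.
        obtain ⟨k, hk⟩ := Nat.exists_eq_add_of_le (Finset.mem_filter.1 hS).2
        have hle : S.card ≤ 2 * m := by simpa using Finset.card_le_univ S
        have e : 2 * m - S.card + k = m := by omega
        calc W ^ (2 * m - S.card) * (((2 * m : ℕ) : ℝ) * B) ^ S.card
            = W ^ (2 * m - S.card) * ((((2 * m : ℕ) : ℝ) * B) ^ m *
                (((2 * m : ℕ) : ℝ) * B) ^ k) := by rw [hk, pow_add _ m k]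
          _ ≤ W ^ (2 * m - S.card) * ((((2 * m : ℕ) : ℝ) * B) ^ m * W ^ k) := by gcongr
          _ = W ^ (2 * m - S.card + k) * (((2 * m : ℕ) : ℝ) * B) ^ m := by rw [pow_add]; ring
          _ = _ := by rw [e]; exact (mul_pow _ _ _).symm
    _ ≤ ∑ S : Finset (Fin (2 * m)), (W * ((2 * m : ℕ) * B)) ^ m :=
        Finset.sum_le_sum_of_subset_of_nonneg (Finset.subset_univ _) fun _ _ _ => by positivity
    _ = _ := by
        rw [Finset.sum_const, Finset.card_univ, Fintype.card_finset, Fintype.card_fin, pow_mul,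
          nsmul_eq_mul]
        norm_num

end

variable {n q : ℕ}
open scoped ComplexOrder

/-- A product of observables need not be self-adjoint. Splitting `Y = P + iQ` into self-adjoint
parts of no larger norm costs the factor 2. -/
theorem HasCorrelationLength.norm_trace_mul_sub_le {D : MetricSpace (Fin n)} {ω : Op n q}
    {ξ C : ℝ} (hω : HasCorrelationLength D ω ξ C) (hC : 0 ≤ C) {Λ₁ Λ₂ : Finset (Fin n)}
    (h₁ : Λ₁.Nonempty) (h₂ : Λ₂.Nonempty) (hd : Disjoint Λ₁ Λ₂) {X Y : Op n q}
    (hX : IsObservableOn Λ₁ X) (hY : ActsOn Λ₂ Y) :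
    ‖(ω * (X * Y)).trace - (ω * X).trace * (ω * Y).trace‖ ≤
      2 * C * (opNorm X * opNorm Y) * Real.exp (-(regionDist D Λ₁ Λ₂) / ξ) := by
  set P : Op n q := (2⁻¹ : ℂ) • (Y + Y.conjTranspose) with hP
  set Q : Op n q := (2⁻¹ * Complex.I : ℂ) • (Y.conjTranspose + (-1 : ℂ) • Y) with hQ
  have hPobs : IsObservableOn Λ₂ P := by
    refine ((hY.add hY.conjTranspose).smul _).isObservableOn ?_
    rw [Matrix.IsHermitian, Matrix.conjTranspose_smul, Matrix.conjTranspose_add,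
      Matrix.conjTranspose_conjTranspose, add_comm]
    simp
  have hQobs : IsObservableOn Λ₂ Q := by
    refine ((hY.conjTranspose.add (hY.smul _)).smul _).isObservableOn ?_
    ext s t
    simp [Matrix.conjTranspose_apply]
    ring
  have hPn : opNorm P ≤ opNorm Y := by
    have := opNorm_add_le Y Y.conjTranspose
    rw [opNorm_conjTranspose] at this
    rw [hP, opNorm_smul]
    norm_num
    linarith
  have hQn : opNorm Q ≤ opNorm Y := by
    have := opNorm_add_le Y.conjTranspose ((-1 : ℂ) • Y)
    rw [opNorm_conjTranspose, opNorm_smul] at this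
    rw [hQ, opNorm_smul]
    norm_num at this ⊢
    linarith
  have hY' : Y = P + Complex.I • Q := by
    ext s t
    simp only [hP, hQ, Matrix.add_apply, Matrix.smul_apply, smul_eq_mul]
    linear_combination (-(1 / 2 : ℂ) * (Y.conjTranspose s t + -1 * Y s t)) * Complex.I_mul_I
  have key : ∀ Z : Op n q, IsObservableOn Λ₂ Z → opNorm Z ≤ opNorm Y →
      ‖(ω * (X * Z)).trace - (ω * X).trace * (ω * Z).trace‖ ≤
        C * (opNorm X * opNorm Y) * Real.exp (-(regionDist D Λ₁ Λ₂) / ξ) := by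
    intro Z hZ hZn
    refine (hω Λ₁ Λ₂ h₁ h₂ hd X Z hX hZ).trans ?_
    have := opNorm_nonneg X
    gcongr
  have e : (ω * (X * Y)).trace - (ω * X).trace * (ω * Y).trace =
      ((ω * (X * P)).trace - (ω * X).trace * (ω * P).trace) +
      Complex.I * ((ω * (X * Q)).trace - (ω * X).trace * (ω * Q).trace) := by
    rw [hY']
    simp only [mul_add, Matrix.trace_add, mul_smul_comm, Matrix.trace_smul, smul_eq_mul]
    ring
  rw [e]
  refine (norm_add_le _ _).trans ?_
  rw [norm_mul, Complex.norm_I, one_mul]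
  linarith [key P hPobs hPn, key Q hQobs hQn]

end SpinSystem
end

/-! ### Moments of sums of centred local observables -/

noncomputable section
namespace SpinSystem
variable {n q : ℕ}
open scoped ComplexOrder

/-- Two regions have distance at most `r`. -/
def Near (D : MetricSpace (Fin n)) (r : ℝ) (Λ Λ' : Finset (Fin n)) : Prop :=
  ∃ x ∈ Λ, ∃ y ∈ Λ', D.dist x y ≤ r

variable {D : MetricSpace (Fin n)} {r : ℝ}

theorem Near.symm {Λ Λ' : Finset (Fin n)} (h : Near D r Λ Λ') : Near D r Λ' Λ := by
  obtain ⟨x, hx, y, hy, hxy⟩ := h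
  exact ⟨y, hy, x, hx, by rwa [D.dist_comm]⟩

theorem disjoint_of_not_near {Λ Λ' : Finset (Fin n)} (hr : 0 ≤ r) (h : ¬ Near D r Λ Λ') :
    Disjoint Λ Λ' := by
  rw [Finset.disjoint_left]
  intro x hx hx'
  exact h ⟨x, hx, x, hx', by rw [D.dist_self]; exact hr⟩

theorem le_regionDist_of_not_near {Λ Λ' : Finset (Fin n)} (hΛ : Λ.Nonempty) (hΛ' : Λ'.Nonempty)
    (h : ¬ Near D r Λ Λ') : r ≤ regionDist D Λ Λ' := by
  obtain ⟨x, hx⟩ := hΛ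
  obtain ⟨y, hy⟩ := hΛ'
  refine le_csInf ⟨_, x, hx, y, hy, rfl⟩ ?_
  rintro _ ⟨x, hx, y, hy, rfl⟩
  by_contra hlt
  exact h ⟨x, hx, y, hy, (not_le.1 hlt).le⟩

section

variable {α : Type*} {s : α → Finset (Fin n)}

open Classical in
-- A region near `Λ` contains a site within `r` of one of the at most `L` sites of `Λ`; the union
-- bound runs over these balls.
theorem sum_near_le [Fintype α] {w : α → ℝ} {A d c : ℝ} {L : ℕ} (hD : BallGrowth D A d) (hr : 1 ≤ r)
    (hw : ∀ a, 0 ≤ w a) (hc : ∀ x, ∑ a with x ∈ s a, w a ≤ c) (hc0 : 0 ≤ c)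
    {Λ : Finset (Fin n)} (hL : Λ.card ≤ L) (hA : 0 ≤ A) :
    ∑ a with Near D r (s a) Λ, w a ≤ L * (A * r ^ d * c) := by
  have hball : ∀ x, ∑ y with D.dist y x ≤ r, c ≤ A * r ^ d * c := by
    intro x
    rw [Finset.sum_const, nsmul_eq_mul]
    refine mul_le_mul_of_nonneg_right ?_ hc0
    have := hD x r hr
    rwa [Set.ncard_eq_toFinset_card', Set.toFinset_ofPred] at this
  have hr0 : 0 ≤ A * r ^ d * c := by
    have : 0 ≤ r := by linarith
    positivity
  calc ∑ a with Near D r (s a) Λ, w a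
      ≤ ∑ a, ∑ x ∈ Λ, ∑ y with D.dist y x ≤ r, if y ∈ s a then w a else 0 := by
        rw [Finset.sum_filter]
        refine Finset.sum_le_sum fun a _ => ?_
        have h0 : ∀ y, 0 ≤ if y ∈ s a then w a else 0 := fun y => by
          split_ifs
          · exact hw a
          · exact le_rfl
        split_ifs with h
        · obtain ⟨y, hy, x, hx, hyx⟩ := h
          refine le_trans ?_ (Finset.single_le_sum (f := fun x => ∑ y with D.dist y x ≤ r,
            if y ∈ s a then w a else 0) (fun x _ => Finset.sum_nonneg fun y _ => h0 y) hx)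
          refine le_trans ?_ (Finset.single_le_sum (fun y _ => h0 y)
            (Finset.mem_filter.2 ⟨Finset.mem_univ y, hyx⟩))
          rw [if_pos hy]
        · exact Finset.sum_nonneg fun x _ => Finset.sum_nonneg fun y _ => h0 y
    _ = ∑ x ∈ Λ, ∑ y with D.dist y x ≤ r, ∑ a with y ∈ s a, w a := by
        rw [Finset.sum_comm]
        refine Finset.sum_congr rfl fun x _ => ?_
        rw [Finset.sum_comm]
        refine Finset.sum_congr rfl fun y _ => ?_
        rw [Finset.sum_filter]
    _ ≤ ∑ x ∈ Λ, A * r ^ d * c := Finset.sum_le_sum fun x _ =>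
        (Finset.sum_le_sum fun y _ => hc y).trans (hball x)
    _ ≤ L * (A * r ^ d * c) := by
        rw [Finset.sum_const, nsmul_eq_mul]
        exact mul_le_mul_of_nonneg_right (by exact_mod_cast hL) hr0

variable {ω : Op n q} {ξ C : ℝ} {Y : α → Op n q}

/-- The expectation of a product of centred local observables is small if one of them is far from
all others. -/
theorem norm_trace_mul_listProd_isolated_le (hω : HasCorrelationLength D ω ξ C) (hC : 0 ≤ C)
    (hξ : 0 < ξ) (hr : 0 ≤ r) (hs : ∀ a, (s a).Nonempty) (hY : ∀ a, IsObservableOn (s a) (Y a))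
    (hY0 : ∀ a, (ω * Y a).trace = 0) {p : ℕ} (x : Fin p → α) {j : Fin p} (hp : ∃ i, i ≠ j)
    (hj : ∀ i, i ≠ j → ¬ Near D r (s (x j)) (s (x i))) :
    ‖(ω * (List.ofFn fun i => Y (x i)).prod).trace‖ ≤
      2 * C * Real.exp (-r / ξ) * ∏ i, opNorm (Y (x i)) := by
  classical
  set f : Fin p → Op n q := fun i => Y (x i) with hf
  set U : Finset (Fin n) := (Finset.univ.erase j).biUnion fun i => s (x i) with hU
  have hUne : U.Nonempty := by
    obtain ⟨i, hi⟩ := hp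
    obtain ⟨y, hy⟩ := hs (x i)
    exact ⟨y, Finset.mem_biUnion.2 ⟨i, Finset.mem_erase.2 ⟨hi, Finset.mem_univ i⟩, hy⟩⟩
  have hUnear : ¬ Near D r (s (x j)) U := by
    rintro ⟨y, hy, z, hz, hyz⟩
    obtain ⟨i, hi, hzi⟩ := Finset.mem_biUnion.1 hz
    exact hj i (Finset.ne_of_mem_erase hi) ⟨y, hy, z, hzi, hyz⟩
  have hcomm : ∀ i, Commute (f j) (f i) := by
    intro i
    by_cases hi : i = j
    · subst hi; exact Commute.refl _
    · exact (hY _).actsOn.commute (disjoint_of_not_near hr (hj i hi)) (hY _).actsOn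
  -- The remaining factors form one operator on the union `U` of their regions, so clustering is
  -- applied only once, between the isolated region and `U`.
  set Q := (List.ofFn (Function.update f j 1)).prod with hQ
  have hQact : ActsOn U Q := by
    refine ActsOn.listProd fun Z hZ => ?_
    obtain ⟨i, rfl⟩ := (List.mem_ofFn' _ _).1 hZ
    by_cases hi : i = j
    · subst hi
      rw [Function.update_self]
      exact ActsOn.one U
    · rw [Function.update_of_ne hi]
      exact (hY _).actsOn.mono (Finset.subset_biUnion_of_mem (fun i => s (x i))
        (Finset.mem_erase.2 ⟨hi, Finset.mem_univ i⟩))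
  have hQn : opNorm Q ≤ ∏ i ∈ Finset.univ.erase j, opNorm (f i) := by
    refine (opNorm_listProd_ofFn_le _).trans ?_
    rw [← Finset.mul_prod_erase _ _ (Finset.mem_univ j), Function.update_self]
    refine (mul_le_of_le_one_left (Finset.prod_nonneg fun _ _ => opNorm_nonneg _)
      opNorm_one_le).trans (le_of_eq ?_)
    refine Finset.prod_congr rfl fun i hi => ?_
    rw [Function.update_of_ne (Finset.ne_of_mem_erase hi)]
  rw [listProd_ofFn_eq_mul_update f j hcomm]
  have h := hω.norm_trace_mul_sub_le hC (hs (x j)) hUne (disjoint_of_not_near hr hUnear)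
    (hY (x j)) hQact
  rw [hY0, zero_mul, sub_zero] at h
  refine h.trans ?_
  have hexp : Real.exp (-(regionDist D (s (x j)) U) / ξ) ≤ Real.exp (-r / ξ) := by
    have := le_regionDist_of_not_near (hs (x j)) hUne hUnear
    gcongr
  have hn : opNorm (Y (x j)) * opNorm Q ≤ ∏ i, opNorm (Y (x i)) := by
    rw [← Finset.mul_prod_erase _ _ (Finset.mem_univ j)]
    exact mul_le_mul_of_nonneg_left hQn (opNorm_nonneg _)
  have h0 := mul_nonneg (opNorm_nonneg (Y (x j))) (opNorm_nonneg Q)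
  have h1 : 0 ≤ 2 * C * ∏ i, opNorm (Y (x i)) := mul_nonneg (by positivity) (h0.trans hn)
  calc _ ≤ 2 * C * (∏ i, opNorm (Y (x i))) * Real.exp (-r / ξ) := by gcongr
    _ = _ := by ring

open Classical in
/-- Bound on the even moments of a sum of centred local observables. -/
theorem norm_trace_mul_sum_pow_le [Fintype α] (hω : HasCorrelationLength D ω ξ C) (hC : 0 ≤ C)
    (hωp : ω.PosSemidef) (hωt : ω.trace = 1) (hξ : 0 < ξ) (hr : 0 ≤ r)
    (hs : ∀ a, (s a).Nonempty) (hY : ∀ a, IsObservableOn (s a) (Y a))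
    (hY0 : ∀ a, (ω * Y a).trace = 0) {W B : ℝ} {m : ℕ} (hm : 1 ≤ m)
    (hW : ∑ a, opNorm (Y a) ≤ W)
    (hB : ∀ b, ∑ a with Near D r (s a) (s b), opNorm (Y a) ≤ B)
    (hB0 : 0 ≤ B) (hBW : ((2 * m : ℕ) : ℝ) * B ≤ W) :
    ‖(ω * (∑ a, Y a) ^ (2 * m)).trace‖ ≤
      4 ^ m * (W * ((2 * m : ℕ) * B)) ^ m + 2 * C * Real.exp (-r / ξ) * W ^ (2 * m) := by
  have hexpand : (∑ a, Y a) ^ (2 * m) =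
      ∑ x : Fin (2 * m) → α, (List.ofFn fun i => Y (x i)).prod := by
    have h := (MultilinearMap.mkPiAlgebraFin ℂ (2 * m) (Op n q)).map_sum
      (fun (_ : Fin (2 * m)) (a : α) => Y a)
    rw [MultilinearMap.mkPiAlgebraFin_apply_const] at h
    rw [h]
    exact Finset.sum_congr rfl fun x _ => MultilinearMap.mkPiAlgebraFin_apply _
  have hprod : ∀ x : Fin (2 * m) → α, 0 ≤ ∏ i, opNorm (Y (x i)) :=
    fun x => Finset.prod_nonneg fun _ _ => opNorm_nonneg _
  set G : (Fin (2 * m) → α) → Prop :=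
    fun x => ∀ j, ∃ i, i ≠ j ∧ Near D r (s (x j)) (s (x i)) with hG
  have hgood := sum_prod_nonisolated_le (R := fun a b => Near D r (s a) (s b)) m
    (fun a => opNorm_nonneg (Y a)) (fun a b h => h.symm) hW hB hB0 hBW
  have hall : ∑ x : Fin (2 * m) → α, ∏ i, opNorm (Y (x i)) ≤ W ^ (2 * m) := by
    have h0 : 0 ≤ ∑ a, opNorm (Y a) := Finset.sum_nonneg fun a _ => opNorm_nonneg _
    have := Finset.prod_univ_sum (fun _ : Fin (2 * m) => (Finset.univ : Finset α))
      (fun _ a => opNorm (Y a))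
    rw [Fintype.piFinset_univ] at this
    rw [← this, Finset.prod_const, Finset.card_univ, Fintype.card_fin]
    exact pow_le_pow_left₀ h0 hW _
  -- Tuples in `G` have no isolated entry and are bounded by counting; the others are bounded by
  -- clustering.
  rw [hexpand, Finset.mul_sum, Matrix.trace_sum, ← Finset.sum_filter_add_sum_filter_not _ G]
  refine (norm_add_le _ _).trans (add_le_add ?_ ?_)
  · refine (norm_sum_le _ _).trans (le_trans (Finset.sum_le_sum fun x _ => ?_) hgood)
    exact (norm_trace_mul_le hωp hωt _).trans (opNorm_listProd_ofFn_le _)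
  · have hcoef : 0 ≤ 2 * C * Real.exp (-r / ξ) := by positivity
    refine (norm_sum_le _ _).trans ?_
    calc _ ≤ ∑ x : Fin (2 * m) → α with ¬ G x, 2 * C * Real.exp (-r / ξ) * ∏ i, opNorm (Y (x i)) := by
          refine Finset.sum_le_sum fun x hx => ?_
          have hx2 := (Finset.mem_filter.1 hx).2
          simp only [hG, not_forall, not_exists, not_and] at hx2
          obtain ⟨j, hj⟩ := hx2
          have : Nontrivial (Fin (2 * m)) := Fin.nontrivial_iff_two_le.2 (by omega)
          exact norm_trace_mul_listProd_isolated_le hω hC hξ hr hs hY hY0 x (exists_ne j) hj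
      _ ≤ ∑ x : Fin (2 * m) → α, 2 * C * Real.exp (-r / ξ) * ∏ i, opNorm (Y (x i)) :=
          Finset.sum_le_sum_of_subset_of_nonneg (Finset.subset_univ _)
            fun x _ _ => mul_nonneg hcoef (hprod x)
      _ = 2 * C * Real.exp (-r / ξ) * ∑ x : Fin (2 * m) → α, ∏ i, opNorm (Y (x i)) :=
          (Finset.mul_sum _ _ _).symm
      _ ≤ _ := mul_le_mul_of_nonneg_left hall hcoef

end

end SpinSystem
end

/-! ### Transfer of concentration to a dominated state -/

noncomputable section
namespace SpinSystem
variable {n q : ℕ}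
open scoped ComplexOrder

theorem trace_mul_eq_ofReal_re {ω X : Op n q} (hω : ω.IsHermitian) (hX : X.IsHermitian) :
    (ω * X).trace = ((ω * X).trace.re : ℂ) := by
  refine (Complex.conj_eq_iff_re.1 ?_).symm
  have h : ((ω * X).conjTranspose).trace = star (ω * X).trace := Matrix.trace_conjTranspose _
  rw [Matrix.conjTranspose_mul, hω, hX, Matrix.trace_mul_comm] at h
  exact h.symm

variable {D : MetricSpace (Fin n)} {ω ρ : Op n q}

/-- Transfer of the concentration of local observables from `ω` to a state dominated by `K ω`. -/
theorem re_trace_sub_mul_le {O : Op n q} {A d ξ C K r η : ℝ} {L m : ℕ}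
    (hD : BallGrowth D A d) (hA : 0 ≤ A) (hC : 0 ≤ C) (hξ : 0 < ξ)
    (hcor : HasCorrelationLength D ω ξ C) (hω : ω.PosSemidef) (hωt : ω.trace = 1)
    (hρ : ρ.PosSemidef) (hρt : ρ.trace = 1) (hK : ((K : ℂ) • ω - ρ).PosSemidef)
    (hO : O.IsHermitian) (hloc : localNorm O ≤ 1) (hL : 1 ≤ L) (hm : 1 ≤ m) (hr : 1 ≤ r)
    (hη : 0 ≤ η) (hBW : ((2 * m : ℕ) : ℝ) * (L * (A * r ^ d * 2)) ≤ 2 * n) (hK0 : 0 ≤ K)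
    (hbound : K * (4 ^ m * (2 * n * ((2 * m : ℕ) * (L * (A * r ^ d * 2)))) ^ m +
      2 * C * Real.exp (-r / ξ) * (2 * n) ^ (2 * m)) ≤ η ^ (2 * m)) :
    ((ρ - ω) * O).trace.re ≤ η + 2 * (n / L) := by
  classical
  obtain ⟨h, ⟨hobs, hsum⟩, hx⟩ := exists_localDecomposition_of_localNorm_lt (a := 1) hO
    (by linarith)
  have hr0 : 0 ≤ r := by linarith
  let α := {Λ : Finset (Fin n) // Λ ≠ ∅ ∧ Λ.card ≤ L}
  let c : α → ℂ := fun a => (ω * h a).trace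
  let Y : α → Op n q := fun a => h a - c a • 1
  have hc : ∀ a, c a = ((c a).re : ℂ) := fun a =>
    trace_mul_eq_ofReal_re hω.isHermitian (hobs a).isHermitian
  have hYobs : ∀ a : α, IsObservableOn a.1 (Y a) := by
    intro a
    have e : Y a = h a + (-c a) • 1 := by simp [Y, sub_eq_add_neg]
    refine ActsOn.isObservableOn ?_ ?_
    · rw [e]
      exact (hobs a).actsOn.add ((ActsOn.one _).smul _)
    · have h1 : star (c a) = c a := Complex.conj_eq_iff_re.2 (hc a).symm
      rw [Matrix.IsHermitian, Matrix.conjTranspose_sub, Matrix.conjTranspose_smul, h1,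
        Matrix.conjTranspose_one, (hobs a).isHermitian]
  have hY0 : ∀ a, (ω * Y a).trace = 0 := by
    intro a
    simp only [Y, mul_sub, mul_smul_comm, mul_one, Matrix.trace_sub, Matrix.trace_smul, hωt,
      smul_eq_mul]
    exact sub_self _
  have hYn : ∀ a, opNorm (Y a) ≤ 2 * opNorm (h a) := by
    intro a
    have e : Y a = h a + (-c a) • 1 := by simp [Y, sub_eq_add_neg]
    have h1 : ‖c a‖ ≤ opNorm (h a) := norm_trace_mul_le hω hωt _
    rw [e]
    refine (opNorm_add_le _ _).trans ?_
    rw [opNorm_smul, norm_neg]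
    have := mul_le_of_le_one_right (norm_nonneg (c a)) (opNorm_one_le (n := n) (q := q))
    linarith
  have hsub : ∀ (P : Finset (Fin n) → Prop) [DecidablePred P], ∑ a : α with P a.1, opNorm (Y a) ≤
      2 * ∑ Λ with Λ ≠ ∅ ∧ P Λ, opNorm (h Λ) := by
    intro P _
    rw [Finset.sum_filter, Finset.mul_sum, Finset.sum_filter]
    calc _ ≤ ∑ a : α, if P a.1 then 2 * opNorm (h a) else 0 := by
          refine Finset.sum_le_sum fun a _ => ?_
          split_ifs
          · exact hYn a
          · exact le_rfl
      _ = ∑ Λ with Λ ≠ ∅ ∧ Λ.card ≤ L, if P Λ then 2 * opNorm (h Λ) else 0 :=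
          (Finset.sum_subtype _ (fun Λ => by rw [Finset.mem_filter_univ])
            fun Λ => if P Λ then 2 * opNorm (h Λ) else 0).symm
      _ ≤ _ := by
          rw [Finset.sum_filter]
          refine Finset.sum_le_sum fun Λ _ => ?_
          have := opNorm_nonneg (h Λ)
          split_ifs <;> first | positivity | tauto
  have hYx : ∀ x, ∑ a : α with x ∈ a.1, opNorm (Y a) ≤ 2 := by
    intro x
    refine (hsub fun Λ => x ∈ Λ).trans ?_
    have : ∑ Λ with Λ ≠ ∅ ∧ x ∈ Λ, opNorm (h Λ) ≤ ∑ Λ with x ∈ Λ, opNorm (h Λ) := by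
      refine Finset.sum_le_sum_of_subset_of_nonneg ?_ fun _ _ _ => opNorm_nonneg _
      intro Λ hΛ
      rw [Finset.mem_filter] at hΛ ⊢
      exact ⟨hΛ.1, hΛ.2.2⟩
    linarith [hx x]
  have hYW : ∑ a, opNorm (Y a) ≤ 2 * n := by
    have h1 := hsub fun _ => True
    have h2 := sum_nonempty_le (fun Λ => opNorm_nonneg (h Λ)) hx
    simp only [and_true, Finset.filter_true] at h1
    linarith
  -- Centring at most doubles each norm, hence the total weight `2 * n` and the weight 2 per site.
  have hmom := norm_trace_mul_sum_pow_le (s := fun a : α => a.1) hcor hC hω hωt hξ hr0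
    (fun a => Finset.nonempty_iff_ne_empty.2 a.2.1) hYobs hY0 hm hYW
    (fun b => sum_near_le hD hr (fun a => opNorm_nonneg (Y a)) hYx (by norm_num) b.2.2 hA)
    (by positivity) hBW
  set S := ∑ a, Y a with hS
  have hSH : S.IsHermitian := by
    rw [hS, Matrix.IsHermitian, Matrix.conjTranspose_sum]
    exact Finset.sum_congr rfl fun a _ => (hYobs a).isHermitian
  -- Jensen's inequality for `ρ`, domination by `K ω`, the moment bound for `ω`, then a `2m`-th
  -- root.
  have hρS : (ρ * S).trace.re ≤ η := by
    have h1 := re_trace_mul_pow_le hρ hρt hSH m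
    have h2 := PosSemidef.re_trace_mul_self_nonneg hK (A := S ^ m) (hSH.pow m)
    rw [← pow_add, ← two_mul, sub_mul, Matrix.trace_sub, smul_mul_assoc, Matrix.trace_smul,
      Complex.sub_re, smul_eq_mul, Complex.re_ofReal_mul] at h2
    have h3 := (Complex.re_le_norm _).trans hmom
    have h4 : (ρ * S).trace.re ^ (2 * m) ≤ η ^ (2 * m) := by
      refine le_trans ?_ hbound
      have := mul_le_mul_of_nonneg_left h3 hK0
      linarith
    rw [← (even_two_mul m).pow_abs] at h4
    exact (le_abs_self _).trans ((pow_le_pow_iff_left₀ (abs_nonneg _) hη (by omega)).1 h4)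
  have hωS : (ω * S).trace = 0 := by
    rw [hS, Finset.mul_sum, Matrix.trace_sum]
    exact Finset.sum_eq_zero fun a _ => hY0 a
  set V : Op n q := ∑ Λ with ¬ Λ.card ≤ L, h Λ with hV
  -- Each large region contains more than `L` spins, so it is counted more than `L` times in the sum
  -- over spins, which is at most `n`.
  have hVn : opNorm V ≤ n / L := by
    have hLpos : (0 : ℝ) < L := by exact_mod_cast hL
    rw [le_div_iff₀ hLpos]
    calc opNorm V * L ≤ (∑ Λ with ¬ Λ.card ≤ L, opNorm (h Λ)) * L :=
          mul_le_mul_of_nonneg_right (opNorm_sum_le _ _) hLpos.le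
      _ = ∑ Λ with ¬ Λ.card ≤ L, L * opNorm (h Λ) := by
          rw [Finset.sum_mul]; exact Finset.sum_congr rfl fun _ _ => mul_comm _ _
      _ ≤ ∑ Λ : Finset (Fin n) with ¬ Λ.card ≤ L, (Λ.card : ℝ) * opNorm (h Λ) := by
          refine Finset.sum_le_sum fun Λ hΛ => ?_
          have h1 := (Finset.mem_filter.1 hΛ).2
          have h2 : (L : ℝ) ≤ Λ.card := by exact_mod_cast (not_le.1 h1).le
          exact mul_le_mul_of_nonneg_right h2 (opNorm_nonneg _)
      _ ≤ ∑ Λ, (Λ.card : ℝ) * opNorm (h Λ) :=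
          Finset.sum_le_sum_of_subset_of_nonneg (Finset.subset_univ _)
            fun Λ _ _ => mul_nonneg (Nat.cast_nonneg _) (opNorm_nonneg _)
      _ ≤ n := by simpa using sum_card_mul_le hx
  obtain ⟨c₀, hc₀⟩ := (hobs ∅).actsOn.eq_smul_one
  -- The scalar part cancels in `ρ - ω` because both traces equal 1.
  have hdecomp : O = S + V + (c₀ + ∑ a, c a) • 1 := by
    have h1 : ∑ Λ with Λ.card ≤ L, h Λ = h ∅ + ∑ a : α, h a := by
      rw [← Finset.add_sum_erase _ h (Finset.mem_filter.2 ⟨Finset.mem_univ ∅, by simp⟩)]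
      congr 1
      refine Finset.sum_subtype _ (fun Λ => ?_) _
      simp
    have h2 : S = ∑ a : α, h a - (∑ a, c a) • 1 := by
      rw [hS, Finset.sum_smul, ← Finset.sum_sub_distrib]
    rw [hsum, ← Finset.sum_filter_add_sum_filter_not _ (fun Λ => Λ.card ≤ L), h1, hc₀, h2,
      add_smul]
    abel
  have htr : ((ρ - ω) * O).trace = (ρ * S).trace + (ρ * V).trace - (ω * V).trace := by
    rw [hdecomp]
    simp only [sub_mul, mul_add, mul_smul_comm, mul_one, Matrix.trace_sub, Matrix.trace_add,
      Matrix.trace_smul, hρt, hωt, hωS, smul_eq_mul]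
    ring
  rw [htr, Complex.sub_re, Complex.add_re]
  have h1 := (Complex.re_le_norm _).trans ((norm_trace_mul_le hρ hρt V).trans hVn)
  have h2 := (neg_le_abs _).trans
    ((Complex.abs_re_le_norm _).trans ((norm_trace_mul_le hω hωt V).trans hVn))
  linarith

end SpinSystem
end

/-! ### Asymptotics of the parameters -/

noncomputable section
namespace SpinSystem
open Filter Topology

theorem eventually_mul_floor_rpow_le (d κ δ : ℝ) (hd : 1 ≤ d) (hδ : 0 < δ) (hκ : 0 ≤ κ) :
    ∀ᶠ n : ℕ in atTop, κ * (⌊(n : ℝ) ^ (1 / (2 * d + 1))⌋₊ : ℝ) ^ (d + 1) ≤ δ * n := by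
  set s := 1 / (2 * d + 1) with hs
  -- The exponent `(d + 1) / (2 * d + 1)` lies below 1.
  have hexp : s * (d + 1) < 1 := by
    rw [hs, one_div, inv_mul_lt_iff₀ (by linarith)]
    linarith
  have hlim : Tendsto (fun n : ℕ => κ * (n : ℝ) ^ (-(1 - s * (d + 1)))) atTop (𝓝 (κ * 0)) :=
    ((tendsto_rpow_neg_atTop (by linarith)).comp tendsto_natCast_atTop_atTop).const_mul κ
  rw [mul_zero] at hlim
  filter_upwards [hlim.eventually_lt_const hδ, eventually_ge_atTop 1] with n hn hn1
  have hn0 : (0 : ℝ) < n := by exact_mod_cast hn1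
  calc κ * (⌊(n : ℝ) ^ s⌋₊ : ℝ) ^ (d + 1) ≤ κ * ((n : ℝ) ^ s) ^ (d + 1) := by
        gcongr
        exact Nat.floor_le (by positivity)
    _ = κ * (n : ℝ) ^ (-(1 - s * (d + 1))) * n := by
        rw [← Real.rpow_mul hn0.le, mul_assoc]
        congr 1
        conv_rhs => rw [← Real.rpow_one (n : ℝ), ← Real.rpow_mul hn0.le, ← Real.rpow_add hn0]
        congr 1
        ring
    _ ≤ δ * n := by gcongr

theorem tendsto_floor_rpow (s : ℝ) (hs : 0 < s) :
    Tendsto (fun n : ℕ => ⌊(n : ℝ) ^ s⌋₊) atTop atTop :=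
  tendsto_nat_floor_atTop.comp ((tendsto_rpow_atTop hs).comp tendsto_natCast_atTop_atTop)

/-- Shells of width `exp (-o(n^s))` and `o(n^s)`: the ratio of the partition function to its
largest shell is at most `exp (o(n^s))`. -/
theorem eventually_shell_factor_le {s β T : ℝ} (hs : 0 < s) (hT : 0 ≤ T)
    {Δ g : ℕ → ℝ} (hg : Asymptotics.IsLittleO atTop g fun n : ℕ => (n : ℝ) ^ s)
    (hΔg : ∀ n, Δ n = Real.exp (-(g n)))
    (hΔ : Asymptotics.IsLittleO atTop Δ fun n : ℕ => (n : ℝ) ^ s) :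
    ∀ᶠ n : ℕ in atTop, 2 * Real.exp (β * Δ n) * (T * n / Δ n + 2) ≤ 4 ^ ⌊(n : ℝ) ^ s⌋₊ := by
  have hx : Tendsto (fun n : ℕ => (n : ℝ) ^ s) atTop atTop :=
    (tendsto_rpow_atTop hs).comp tendsto_natCast_atTop_atTop
  have hlog : Asymptotics.IsLittleO atTop (fun n : ℕ => Real.log n) fun n : ℕ => (n : ℝ) ^ s :=
    (isLittleO_log_rpow_atTop hs).comp_tendsto tendsto_natCast_atTop_atTop
  have hconst : ∀ᶠ n : ℕ in atTop, 2 * (T + 2) ≤ Real.exp ((n : ℝ) ^ s / 8) :=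
    (Real.tendsto_exp_atTop.comp (hx.atTop_div_const (by norm_num))).eventually_ge_atTop _
  -- The exponents `x/8 + x/8 + x/4 + x/4 = 3x/4` stay below `x - 1` once `x ≥ 4`, and `e < 4`
  -- absorbs the floor.
  filter_upwards [hg.bound (by norm_num : (0 : ℝ) < 1 / 4), (hΔ.const_mul_left β).bound
    (by norm_num : (0 : ℝ) < 1 / 4), hlog.bound (by norm_num : (0 : ℝ) < 1 / 8), hconst,
    hx.eventually_ge_atTop 4, eventually_ge_atTop 1] with n h1 h2 h3 h4 h5 h6
  set x := (n : ℝ) ^ s with hxdef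
  have hn1 : (1 : ℝ) ≤ n := by exact_mod_cast h6
  have hx0 : 0 ≤ x := by linarith
  rw [Real.norm_of_nonneg hx0] at h1 h2 h3
  have hn : (n : ℝ) ≤ Real.exp (x / 8) := by
    rw [← Real.log_le_iff_le_exp (by linarith)]
    have := (le_abs_self _).trans h3
    linarith
  have hinv : T * n / Δ n + 2 ≤ (T + 2) * n * Real.exp (x / 4) := by
    have e1 : T * n / Δ n ≤ T * n * Real.exp (x / 4) := by
      rw [hΔg, Real.exp_neg, div_inv_eq_mul]
      have : g n ≤ x / 4 := by
        have := (le_abs_self _).trans h1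
        linarith
      gcongr
    have e2 : 1 ≤ Real.exp (x / 4) := Real.one_le_exp (by linarith)
    nlinarith
  have hb : Real.exp (β * Δ n) ≤ Real.exp (x / 4) := by
    rw [Real.exp_le_exp]
    have := (le_abs_self _).trans h2
    linarith
  have h4m : Real.exp (x - 1) ≤ 4 ^ ⌊x⌋₊ := by
    have e1 : x - 1 ≤ ⌊x⌋₊ := by linarith [Nat.lt_floor_add_one x]
    have e2 : Real.exp 1 ≤ 4 := by linarith [Real.exp_one_lt_d9]
    calc Real.exp (x - 1) ≤ Real.exp ((⌊x⌋₊ : ℝ) * 1) := by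
          rw [mul_one]; exact Real.exp_le_exp.2 e1
      _ = Real.exp 1 ^ ⌊x⌋₊ := Real.exp_nat_mul 1 _
      _ ≤ 4 ^ ⌊x⌋₊ := by gcongr
  calc 2 * Real.exp (β * Δ n) * (T * n / Δ n + 2)
      ≤ 2 * Real.exp (x / 4) * ((T + 2) * n * Real.exp (x / 4)) := by
        have : 0 ≤ T * n / Δ n + 2 := by rw [hΔg]; positivity
        gcongr
    _ = (2 * (T + 2)) * n * (Real.exp (x / 4) * Real.exp (x / 4)) := by ring
    _ ≤ Real.exp (x / 8) * Real.exp (x / 8) * (Real.exp (x / 4) * Real.exp (x / 4)) := by gcongr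
    _ = Real.exp (3 * x / 4) := by
        rw [← Real.exp_add, ← Real.exp_add, ← Real.exp_add]; congr 1; ring
    _ ≤ Real.exp (x - 1) := Real.exp_le_exp.2 (by linarith)
    _ ≤ _ := h4m

/-- Each of the two summands receives half of the target. The factors `4 ^ m` from `K` and from the
norms or the subset count are absorbed inside the `m`-th powers: 512 comes from `4 * e * (2n)² ≤
(εn/4)² / 2`, and `2 ^ m` pays for `C`. -/
theorem moment_bound_le {ε n b C K e : ℝ} {m : ℕ} (hn : 0 ≤ n) (hm : 1 ≤ m)
    (hb0 : 0 ≤ b) (hC : 0 ≤ C) (hK : K ≤ 4 ^ m) (hb : 4096 * b ≤ ε ^ 2 * n)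
    (he0 : 0 ≤ e) (he : 512 * e ≤ ε ^ 2) (hCm : 4 * C ≤ 2 ^ m) :
    K * (4 ^ m * (2 * n * b) ^ m + 2 * C * e ^ m * (2 * n) ^ (2 * m)) ≤
      (ε * n / 4) ^ (2 * m) := by
  set v := (ε * n / 4) ^ 2 with hv
  have hv0 : 0 ≤ v := by positivity
  have hhalf : ((1 : ℝ) / 2) ^ m ≤ 1 / 2 := by
    simpa using pow_le_pow_of_le_one (by norm_num : (0 : ℝ) ≤ 1 / 2) (by norm_num) hm
  have h1 : 4 ^ m * (4 ^ m * (2 * n * b) ^ m) ≤ 1 / 2 * v ^ m := by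
    calc _ = (4 * (4 * (2 * n * b))) ^ m := by rw [mul_pow 4 (4 * _), mul_pow 4]
      _ ≤ (1 / 2 * v) ^ m := by
          refine pow_le_pow_left₀ (by positivity) ?_ m
          rw [hv]
          nlinarith
      _ = (1 / 2) ^ m * v ^ m := mul_pow _ _ _
      _ ≤ _ := by gcongr
  have h2 : 4 ^ m * (2 * C * e ^ m * (2 * n) ^ (2 * m)) ≤ 1 / 2 * v ^ m := by
    calc 4 ^ m * (2 * C * e ^ m * (2 * n) ^ (2 * m))
        = 2 * C * (4 * e * (2 * n) ^ 2) ^ m := by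
          rw [mul_pow (4 * e), mul_pow 4, pow_mul]; ring
      _ ≤ 2 * C * (1 / 2 * v) ^ m := by
          refine mul_le_mul_of_nonneg_left (pow_le_pow_left₀ (by positivity) ?_ m) (by positivity)
          rw [hv]
          nlinarith [sq_nonneg n]
      _ = 2 * C * (1 / 2) ^ m * v ^ m := by rw [mul_pow]; ring
      _ ≤ 1 / 2 * v ^ m := by
          refine mul_le_mul_of_nonneg_right ?_ (by positivity)
          rw [one_div, inv_pow, ← div_eq_mul_inv, div_le_iff₀ (by positivity)]
          linarith
  calc _ ≤ 4 ^ m * (4 ^ m * (2 * n * b) ^ m + 2 * C * e ^ m * (2 * n) ^ (2 * m)) := by gcongr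
    _ ≤ v ^ m := by rw [mul_add]; linarith
    _ = _ := by rw [hv, pow_mul]

end SpinSystem
end

/-! ### Choice of parameters and conclusion -/

theorem mainTheorem7 (q k : ℕ) (hq : 1 ≤ q) (d A ξ C β M : ℝ)
    (hd : 1 ≤ d) (hA : 0 < A) (hξ : 0 < ξ) (hC : 0 < C) (hβ : 0 ≤ β)
    (Δ : ℕ → ℝ)
    (hΔ_lower : ∃ g : ℕ → ℝ,
      Asymptotics.IsLittleO Filter.atTop g (fun n : ℕ => (n : ℝ) ^ (1 / (2 * d + 1))) ∧
        ∀ n, Δ n = Real.exp (-(g n)))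
    (hΔ_upper :
      Asymptotics.IsLittleO Filter.atTop Δ (fun n : ℕ => (n : ℝ) ^ (1 / (2 * d + 1)))) :
    ∀ ε : ℝ, 0 < ε → ∃ N : ℕ, ∀ n : ℕ, N ≤ n →
      ∀ (D : MetricSpace (Fin n)) (H : SpinSystem.Op n q) (Estar : ℝ),
        H.IsHermitian →
        (β = 0 → SpinSystem.localNorm H ≤ M) →
        SpinSystem.BallGrowth D A d →
        SpinSystem.HasCorrelationLength D (SpinSystem.gibbsState β H) ξ C →
        SpinSystem.IsOptimalEnergy β H (Δ n) Estar →
        SpinSystem.kLocalW1Norm k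
          (SpinSystem.microcanonicalState H Estar (Δ n) - SpinSystem.gibbsState β H) / (n : ℝ)
            < ε := by
  intro ε hε
  obtain ⟨g, hg, hΔg⟩ := hΔ_lower
  have hs : 0 < 1 / (2 * d + 1) := by positivity
  -- This makes the contribution `2n / L` of the large regions at most `εn/4`.
  obtain ⟨L, hL⟩ := exists_nat_ge (max 1 (8 / ε))
  have hL1 : 1 ≤ L := by exact_mod_cast (le_max_left _ _).trans hL
  have hL8 : 8 / ε ≤ L := (le_max_right _ _).trans hL
  have hL0 : (0 : ℝ) < L := by exact_mod_cast hL1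
  -- The radius is `r = θm`; the decay per unit of `m` must beat the constant of `moment_bound_le`.
  obtain ⟨θ, hθ1, hθ⟩ : ∃ θ : ℝ, 1 ≤ θ ∧ 512 * Real.exp (-θ / ξ) ≤ ε ^ 2 := by
    refine ⟨max 1 (ξ * Real.log (512 / ε ^ 2)), le_max_left _ _, ?_⟩
    have h1 : Real.log (512 / ε ^ 2) ≤ max 1 (ξ * Real.log (512 / ε ^ 2)) / ξ := by
      rw [le_div_iff₀ hξ, mul_comm]
      exact le_max_right _ _
    rw [Real.log_le_iff_le_exp (by positivity), div_le_iff₀ (by positivity)] at h1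
    rw [neg_div, Real.exp_neg, mul_inv_le_iff₀ (Real.exp_pos _), mul_comm]
    linarith
  -- At `r = θm` the quantity `2 * m * B` equals `κ * m ^ (d + 1)`. It is compared below with `2 *
  -- n` for the counting lemma and with `ε² n / 4096` for the moment bound.
  set κ := 2 * (L * (A * θ ^ d * 2)) with hκ
  have hκ0 : 0 ≤ κ := by positivity
  have hpow : Filter.Tendsto (fun n : ℕ => (2 : ℝ) ^ ⌊(n : ℝ) ^ (1 / (2 * d + 1))⌋₊)
      Filter.atTop Filter.atTop :=
    (tendsto_pow_atTop_atTop_of_one_lt (by norm_num)).comp (SpinSystem.tendsto_floor_rpow _ hs)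
  refine Filter.eventually_atTop.1 ?_
  filter_upwards [Filter.eventually_ge_atTop 1,
    (SpinSystem.tendsto_floor_rpow _ hs).eventually_ge_atTop 1,
    hpow.eventually_ge_atTop (4 * C),
    SpinSystem.eventually_mul_floor_rpow_le d κ 2 hd (by norm_num) hκ0,
    SpinSystem.eventually_mul_floor_rpow_le d κ (ε ^ 2 / 4096) hd (by positivity) hκ0,
    SpinSystem.eventually_shell_factor_le (β := β) hs (SpinSystem.energyRange_nonneg q M hβ) hg hΔg
      hΔ_upper] with n hn hm hCm hκ1 hκ2 hK
  intro D H Estar hH hM hball hcor hopt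
  set m := ⌊(n : ℝ) ^ (1 / (2 * d + 1))⌋₊ with hmdef
  have hn0 : (0 : ℝ) < n := by exact_mod_cast hn
  have hm1 : (1 : ℝ) ≤ m := by exact_mod_cast hm
  have hΔ0 : 0 < Δ n := by rw [hΔg]; exact Real.exp_pos _
  have : Nonempty (SpinSystem.Config n q) := ⟨fun _ => ⟨0, hq⟩⟩
  set K := 2 * Real.exp (β * Δ n) * (SpinSystem.energyRange q β M * n / Δ n + 2) with hKdef
  have hK0 : 0 ≤ K := by
    have := SpinSystem.energyRange_nonneg q M hβ
    positivity
  have hpart := SpinSystem.partition_le hH hn hβ hM hΔ0 hopt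
  have hN := SpinSystem.shellCard_pos hH hpart
  have hr : 1 ≤ θ * m := by nlinarith
  have hb : ((2 * m : ℕ) : ℝ) * (L * (A * (θ * m) ^ d * 2)) = κ * (m : ℝ) ^ (d + 1) := by
    rw [Real.mul_rpow (by linarith) (by linarith), Real.rpow_add_one (by linarith), hκ]
    push_cast
    ring
  have hexp : Real.exp (-(θ * m) / ξ) = Real.exp (-θ / ξ) ^ m := by
    rw [← Real.exp_nat_mul]
    congr 1
    ring
  have htail : 2 * ((n : ℝ) / L) ≤ ε * n / 4 := by
    rw [div_le_iff₀ hε] at hL8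
    rw [← mul_div_assoc, div_le_iff₀ hL0]
    nlinarith
  have hW : SpinSystem.kLocalW1Norm k
      (SpinSystem.microcanonicalState H Estar (Δ n) - SpinSystem.gibbsState β H) ≤
        ε * n / 2 := by
    -- The concentrated part and the tail give `εn/4` each; the total `εn/2` leaves room for the
    -- strict inequality.
    refine Real.sSup_le ?_ (by positivity)
    rintro w ⟨O, hO, -, hloc, rfl⟩
    refine (SpinSystem.re_trace_sub_mul_le (η := ε * n / 4) (L := L) (m := m) (r := θ * m)
      hball hA.le hC.le hξ hcor (SpinSystem.posSemidef_gibbsState hH β)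
      (SpinSystem.trace_gibbsState hH β) (SpinSystem.posSemidef_microcanonicalState hH _ _)
      (SpinSystem.trace_microcanonicalState hH hN)
      (SpinSystem.posSemidef_smul_gibbsState_sub hH hβ hpart hK0 hN) hO hloc hL1 hm hr
      (by positivity) (by rw [hb]; exact hκ1) hK0 ?_).trans (by linarith)
    rw [hb, hexp]
    refine SpinSystem.moment_bound_le hn0.le hm (by positivity) hC.le hK ?_
      (Real.exp_pos _).le hθ hCm
    linarith
  rw [div_lt_iff₀ hn0]
  nlinarith
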